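/- Let $\overline G$ be a Lie group and let $(\overline M,\overline g)$, $\overline M=\overline G/\overline H$, be a connected homogeneous Riemannian manifold of dimension $n$: $\overline G$ acts smoothly, transitively, effectively and by isometries on $\overline M$, and $\overline H$ is the isotropy group of the point $o=[e]\in\overline M$. For a Lie group $L$ with Lie algebra $\mathfrak l$ and a closed subgroup $K\subset L$ with Lie algebra $\mathfrak k$, a reductive decomposition of $L/K$ is a direct sum decomposition $\mathfrak l=\mathfrak k+\mathfrak p$ into vector subspaces with $\mathrm{Ad}(K)\mathfrak p\subset\mathfrak p$. Assume that $\overline M=\overline G/\overline H$ is equipped with a reductive decomposition $\overline{\mathfrak g}=\overline{\mathfrak h}+\overline{\mathfrak m}$. For $X\in\overline{\mathfrak g}$ let $X^*_p=\frac{d}{dt}\big|_{t=0}\exp(tX)\cdot p$ be the fundamental vector field, let $\overline\nabla$ be the Levi-Civita connection of $\overline g$, and let $\overline K_X\colon T_o\overline M\to T_o\overline M$, $\overline K_X(v)=\overline\nabla_vX^*$, be the Kostant operator. Let $\overline{\mathfrak B}$ be the Killing form of the Lie algebra $\mathfrak{so}(T_o\overline M,\overline g_o)\simeq\mathfrak{so}(n)$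 of skew-symmetric endomorphisms if $n\neq 2$; if $n=2$, where the Killing form vanishes identically, let $\overline{\mathfrak B}(A,B)=\operatorname{tr}(AB)$. Then $X\mapsto\overline K_X$ is a linear map from $\overline{\mathfrak g}$ to $\mathfrak{so}(T_o\overline M,\overline g_o)$, so that $$\overline\phi(X,Y)=-\overline{\mathfrak B}(\overline K_X,\overline K_Y),\qquad X,Y\in\overline{\mathfrak g},$$ is a well-defined bilinear form on $\overline{\mathfrak g}$, and $\overline\phi$ is positive definite on $\overline{\mathfrak h}$. Moreover, let $G\subset\overline G$ be a Lie subgroup with Lie algebra $\mathfrak g\subset\overline{\mathfrak g}$ such that the orbit $M=G\cdot o$ is closed in $\overline M$, let $H=\overline H\cap G$, and let $\mathfrak h$ be the Lie algebra of $H$. Then $$\mathfrak g=\mathfrak h+\mathfrak m,\qquad \mathfrak m=\mathfrak h^{\perp}\cap\mathfrak g=\{X\in\mathfrak g:\ \overline\phi(X,Y)=0\ \text{ for all } Y\in\mathfrak h\},$$ is a reductive decomposition of $M=G/H$. -/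

import Mathlib

open Bundle Manifold VectorField
open scoped ContDiff

set_option linter.unusedSectionVars false

noncomputable section

theorem finiteDimensional_tangentSpace {E : Type*} [NormedAddCommGroup E] [NormedSpace ℝ E]
    [FiniteDimensional ℝ E] {H : Type*} [TopologicalSpace H] {I : ModelWithCorners ℝ E H}
    {M : Type*} [TopologicalSpace M] [ChartedSpace H M] (p : M) :
    FiniteDimensional ℝ (TangentSpace I p) :=
  inferInstanceAs (FiniteDimensional ℝ E)

section LeviCivita

variable {E : Type*} [NormedAddCommGroup E] [NormedSpace ℝ E]
  {H : Type*} [TopologicalSpace H] {I : ModelWithCorners ℝ E H}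
  {M : Type*} [TopologicalSpace M] [ChartedSpace H M]
  [RiemannianBundle (fun x : M => TangentSpace I x)]

/-- The right-hand side of Koszul's formula, i.e. the value at `p` of
`½ (V⟨Y,W⟩ + Y⟨V,W⟩ - W⟨V,Y⟩ + ⟨[V,Y],W⟩ - ⟨[V,W],Y⟩ - ⟨[Y,W],V⟩)`,
which is `⟨∇_V Y, W⟩` for the Levi-Civita connection `∇`. -/
def koszul (Y V W : Π x : M, TangentSpace I x) (p : M) : ℝ :=
  (mvfderiv I (fun x => inner ℝ (Y x) (W x)) p (V p)
    + mvfderiv I (fun x => inner ℝ (V x) (W x)) p (Y p)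
    - mvfderiv I (fun x => inner ℝ (V x) (Y x)) p (W p)
    + inner ℝ (mlieBracket I V Y p) (W p)
    - inner ℝ (mlieBracket I V W p) (Y p)
    - inner ℝ (mlieBracket I Y W p) (V p)) / 2

variable [IsManifold I 2 M] [IsContMDiffRiemannianBundle I 1 E (fun x : M => TangentSpace I x)]

theorem mdifferentiableAt_inner {V W : Π x : M, TangentSpace I x} {p : M}
    (hV : MDiffAt (T% V) p) (hW : MDiffAt (T% W) p) :
    MDiffAt (fun x => inner ℝ (V x) (W x)) p :=
  MDifferentiableAt.inner_bundle (IB := I) (F := E) (E := fun x : M => TangentSpace I x)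
    (b := fun x => x) hV hW

variable [CompleteSpace E]

theorem koszul_tensorial_left {Y W : Π x : M, TangentSpace I x} {p : M} (hY : MDiffAt (T% Y) p)
    (hW : MDiffAt (T% W) p) :
    TensorialAt I E (fun V => koszul (I := I) Y V W p) p where
  smul {f V} hf hV := by
    have h1 := mvfderiv_fun_mul (I := I) hf (mdifferentiableAt_inner hV hW)
    have h2 := mvfderiv_fun_mul (I := I) hf (mdifferentiableAt_inner hV hY)
    simp only [koszul, Pi.smul_apply', inner_smul_left, inner_smul_right, mlieBracket_smul_left hf hV, inner_add_left, RCLike.conj_to_real]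
    rw [h1, h2]
    simp [real_inner_comm]
    ring
  add {V V'} hV hV' := by
    have h1 := mvfderiv_fun_add (I := I) (mdifferentiableAt_inner hV hW) (mdifferentiableAt_inner hV' hW)
    have h2 := mvfderiv_fun_add (I := I) (mdifferentiableAt_inner hV hY) (mdifferentiableAt_inner hV' hY)
    simp only [koszul, Pi.add_apply, mlieBracket_add_left hV hV', inner_add_left, inner_add_right]
    rw [h1, h2]
    simp
    ring

theorem koszul_tensorial_right {Y V : Π x : M, TangentSpace I x} {p : M} (hY : MDiffAt (T% Y) p)
    (hV : MDiffAt (T% V) p) :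
    TensorialAt I E (fun W => koszul (I := I) Y V W p) p where
  smul {f W} hf hW := by
    have h1 := mvfderiv_fun_mul (I := I) hf (mdifferentiableAt_inner hY hW)
    have h2 := mvfderiv_fun_mul (I := I) hf (mdifferentiableAt_inner hV hW)
    simp only [koszul, Pi.smul_apply', inner_smul_left, inner_smul_right, mlieBracket_smul_right hf hW, inner_add_left, RCLike.conj_to_real]
    rw [h1, h2]
    simp [real_inner_comm]
    ring
  add {W W'} hW hW' := by
    have h1 := mvfderiv_fun_add (I := I) (mdifferentiableAt_inner hY hW) (mdifferentiableAt_inner hY hW')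
    have h2 := mvfderiv_fun_add (I := I) (mdifferentiableAt_inner hV hW) (mdifferentiableAt_inner hV hW')
    simp only [koszul, Pi.add_apply, mlieBracket_add_right hW hW', inner_add_left, inner_add_right]
    rw [h1, h2]
    simp
    ring

theorem koszul_add {Y Y' V W : Π x : M, TangentSpace I x} {p : M} (hY : MDiffAt (T% Y) p)
    (hY' : MDiffAt (T% Y') p) (hV : MDiffAt (T% V) p) (hW : MDiffAt (T% W) p) :
    koszul (Y + Y') V W p = koszul Y V W p + koszul Y' V W p := by
  have h1 := mvfderiv_fun_add (I := I) (mdifferentiableAt_inner hY hW) (mdifferentiableAt_inner hY' hW)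
  have h2 := mvfderiv_fun_add (I := I) (mdifferentiableAt_inner hV hY) (mdifferentiableAt_inner hV hY')
  simp only [koszul, Pi.add_apply, mlieBracket_add_right hY hY', mlieBracket_add_left hY hY',
    inner_add_left, inner_add_right]
  rw [h1, h2]
  simp
  ring

theorem koszul_smul {f : M → ℝ} {Y V W : Π x : M, TangentSpace I x} {p : M}
    (hf : MDiffAt f p) (hY : MDiffAt (T% Y) p)
    (hV : MDiffAt (T% V) p) (hW : MDiffAt (T% W) p) :
    koszul (f • Y) V W p = f p * koszul Y V W p + mvfderiv I f p (V p) * inner ℝ (Y p) (W p) := by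
  have h1 := mvfderiv_fun_mul (I := I) hf (mdifferentiableAt_inner hY hW)
  have h2 := mvfderiv_fun_mul (I := I) hf (mdifferentiableAt_inner hV hY)
  simp only [koszul, Pi.smul_apply', inner_smul_left, inner_smul_right,
    mlieBracket_smul_left hf hY, mlieBracket_smul_right hf hY, inner_add_left, RCLike.conj_to_real]
  rw [h1, h2]
  simp [real_inner_comm]
  ring

variable [FiniteDimensional ℝ E]

/-- At a point where `Y` is differentiable, the Koszul expression depends only on the values of
`V` and `W` there. -/
def koszulForm (Y : Π x : M, TangentSpace I x) (p : M) (hY : MDiffAt (T% Y) p) :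
    TangentSpace I p →L[ℝ] TangentSpace I p →L[ℝ] ℝ :=
  TensorialAt.mkHom₂ (I := I) (F := E) (F' := E) (V := fun x : M => TangentSpace I x)
    (V' := fun x : M => TangentSpace I x) (fun V W => koszul Y V W p) p
    (fun _ hW => koszul_tensorial_left hY hW) (fun _ hV => koszul_tensorial_right hY hV)

/-- The vector representing a linear form with respect to the Riemannian metric at `p`. -/
def sharp (p : M) : (TangentSpace I p →L[ℝ] ℝ) →L[ℝ] TangentSpace I p :=
  haveI : FiniteDimensional ℝ (TangentSpace I p) := finiteDimensional_tangentSpace p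
  haveI : CompleteSpace (TangentSpace I p) := FiniteDimensional.complete ℝ _
  ((InnerProductSpace.toDual ℝ (TangentSpace I p)).symm : StrongDual ℝ (TangentSpace I p) ≃ₗᵢ[ℝ] TangentSpace I p).toContinuousLinearEquiv.toContinuousLinearMap

theorem inner_sharp (p : M) (l : TangentSpace I p →L[ℝ] ℝ) (w : TangentSpace I p) :
    inner ℝ (sharp p l) w = l w := by
  have : FiniteDimensional ℝ (TangentSpace I p) := finiteDimensional_tangentSpace p
  have : CompleteSpace (TangentSpace I p) := FiniteDimensional.complete ℝ _
  exact InnerProductSpace.toDual_symm_apply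

open Classical in
/-- `leviCivitaFun Y p v` is `∇_v Y` at `p`; it has the junk value `0` where `Y` is not
differentiable. -/
def leviCivitaFun (Y : Π x : M, TangentSpace I x) (p : M) :
    TangentSpace I p →L[ℝ] TangentSpace I p :=
  if hY : MDiffAt (T% Y) p then sharp p ∘L koszulForm Y p hY else 0

theorem inner_leviCivitaFun {Y V W : Π x : M, TangentSpace I x} {p : M}
    (hY : MDiffAt (T% Y) p) (hV : MDiffAt (T% V) p) (hW : MDiffAt (T% W) p) :
    inner ℝ (leviCivitaFun Y p (V p)) (W p) = koszul Y V W p := by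
  rw [leviCivitaFun, dif_pos hY, ContinuousLinearMap.comp_apply, inner_sharp]
  exact TensorialAt.mkHom₂_apply _ _ hV hW

theorem eq_of_forall_inner {p : M} {A B : TangentSpace I p →L[ℝ] TangentSpace I p}
    (h : ∀ V W : Π x : M, TangentSpace I x, MDiffAt (T% V) p → MDiffAt (T% W) p →
      inner ℝ (A (V p)) (W p) = inner ℝ (B (V p)) (W p)) : A = B := by
  ext1 v
  refine ext_inner_right ℝ fun w => ?_
  have := h (FiberBundle.extend E v) (FiberBundle.extend E w)
    (FiberBundle.mdifferentiableAt_extend ..) (FiberBundle.mdifferentiableAt_extend ..)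
  simpa using this

/-- The Levi-Civita connection of a Riemannian manifold. `leviCivita Y p v` is `(∇_v Y)_p`. -/
def leviCivita : CovariantDerivative I E (fun x : M => TangentSpace I x) where
  toFun := leviCivitaFun
  isCovariantDerivativeOnUniv :=
    { add := by
        intro Y Y' p hY hY' _
        refine eq_of_forall_inner fun V W hV hW => ?_
        have hS : MDiffAt (T% (Y + Y')) p := mdifferentiableAt_add_section hY hY'
        rw [inner_leviCivitaFun hS hV hW, koszul_add hY hY' hV hW,
          add_apply, inner_add_left, inner_leviCivitaFun hY hV hW,
          inner_leviCivitaFun hY' hV hW]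
      leibniz := by
        intro Y f p hY hf _
        refine eq_of_forall_inner fun V W hV hW => ?_
        have hS : MDiffAt (T% (f • Y)) p := hf.smul_section hY
        rw [inner_leviCivitaFun hS hV hW, koszul_smul hf hY hV hW,
          add_apply, smul_apply, inner_add_left,
          inner_smul_left, inner_leviCivitaFun hY hV hW, ContinuousLinearMap.smulRight_apply,
          inner_smul_left]
        rfl }

/-- The Levi-Civita connection is torsion-free. -/
theorem leviCivita_torsion : (leviCivita (I := I) (M := M)).torsion = 0 := by
  rw [CovariantDerivative.torsion_eq_zero_iff]
  intro X Y p hX hY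
  refine ext_inner_right ℝ fun w => ?_
  obtain ⟨W, hW, rfl⟩ : ∃ W : Π x : M, TangentSpace I x, MDiffAt (T% W) p ∧ W p = w :=
    ⟨FiberBundle.extend E w, FiberBundle.mdifferentiableAt_extend .., by simp⟩
  rw [inner_sub_left]
  change inner ℝ (leviCivitaFun Y p (X p)) (W p) - inner ℝ (leviCivitaFun X p (Y p)) (W p) = _
  rw [inner_leviCivitaFun hY hX hW, inner_leviCivitaFun hX hY hW]
  simp only [koszul, real_inner_comm, mlieBracket_swap_apply (V := Y) (W := X), inner_neg_left]
  ring

/-- The Levi-Civita connection is compatible with the metric. -/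
theorem leviCivita_metric {X Y Z : Π x : M, TangentSpace I x} {p : M} (hX : MDiffAt (T% X) p)
    (hY : MDiffAt (T% Y) p) (hZ : MDiffAt (T% Z) p) :
    mvfderiv I (fun x => inner ℝ (Y x) (Z x)) p (X p)
      = inner ℝ (leviCivita Y p (X p)) (Z p) + inner ℝ (Y p) (leviCivita Z p (X p)) := by
  change _ = inner ℝ (leviCivitaFun Y p (X p)) (Z p) + inner ℝ (Y p) (leviCivitaFun Z p (X p))
  rw [real_inner_comm (leviCivitaFun Z p (X p)), inner_leviCivitaFun hY hX hZ,
    inner_leviCivitaFun hZ hX hY]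
  simp only [koszul, mlieBracket_swap_apply (V := Z) (W := Y), inner_neg_left]
  simp only [real_inner_comm]
  ring

end LeviCivita

section LieGroups

variable {E : Type*} [NormedAddCommGroup E] [NormedSpace ℝ E]
  {H : Type*} [TopologicalSpace H] {I : ModelWithCorners ℝ E H}
  {G : Type*} [TopologicalSpace G] [ChartedSpace H G] [Group G]

/-- `γ` is the one-parameter subgroup `t ↦ exp (t X)` of `G` with initial velocity `X`. -/
def IsOneParameterSubgroup (γ : ℝ → G) (X : GroupLieAlgebra I G) : Prop :=
  (∀ s t, γ (s + t) = γ s * γ t) ∧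
    HasMFDerivAt 𝓘(ℝ, ℝ) I γ 0 (ContinuousLinearMap.toSpanSingleton ℝ (X : E))

variable (I) in
/-- The Lie algebra of a (closed) subgroup `K` of a Lie group, as a subspace of the Lie algebra of
the group: it consists of the `X` with `exp (t X) ∈ K` for all real `t`. (By Cartan's theorem these
`X` already form a linear subspace, so that the span adds no further element.) -/
def subgroupLieAlgebra (K : Subgroup G) : Submodule ℝ (GroupLieAlgebra I G) :=
  Submodule.span ℝ {X | ∃ γ : ℝ → G, IsOneParameterSubgroup γ X ∧ ∀ t, γ t ∈ K}

variable (I) in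
/-- The adjoint representation: `Ad a` is the differential at `1` of `x ↦ a x a⁻¹`. -/
def Ad (a : G) : GroupLieAlgebra I G → GroupLieAlgebra I G :=
  fun X => (mfderiv I I (fun x : G => a * x * a⁻¹) 1 X : E)

/-- `m` is the complement in a reductive decomposition `Lie(G) = Lie(K) + m` of the homogeneous
space `G/K`: the sum is direct and `m` is `Ad(K)`-invariant. -/
structure IsReductiveDecomposition (K : Subgroup G) (m : Submodule ℝ (GroupLieAlgebra I G)) :
    Prop where
  isCompl : IsCompl (subgroupLieAlgebra I K) m
  ad_mem : ∀ a ∈ K, ∀ X ∈ m, Ad I a X ∈ m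

variable {E' : Type*} [NormedAddCommGroup E'] [NormedSpace ℝ E']
  {H' : Type*} [TopologicalSpace H'] {I' : ModelWithCorners ℝ E' H'}
  {G' : Type*} [TopologicalSpace G'] [ChartedSpace H' G'] [Group G']

variable (I I') in
/-- `ι` presents the Lie group `G` as an (immersed) Lie subgroup of `G'`. -/
structure IsLieSubgroup (ι : G →* G') : Prop where
  contMDiff : ContMDiff I I' ∞ ι
  injective : Function.Injective ι
  mfderiv_injective : ∀ a : G, Function.Injective (mfderiv I I' ι a)

variable (I I') in
/-- The differential at `1` of a homomorphism of Lie groups, as a map of Lie algebras. -/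
def lieMap (ι : G →* G') : GroupLieAlgebra I G →ₗ[ℝ] GroupLieAlgebra I' G' :=
  (show E →L[ℝ] E' from mfderiv I I' ι 1).toLinearMap

end LieGroups

section Homogeneous

variable {F : Type*} [NormedAddCommGroup F] [NormedSpace ℝ F]
  {HG : Type*} [TopologicalSpace HG] {J : ModelWithCorners ℝ F HG}
  {E : Type*} [NormedAddCommGroup E] [NormedSpace ℝ E]
  {H : Type*} [TopologicalSpace H] {I : ModelWithCorners ℝ E H}
  {G : Type*} [TopologicalSpace G] [ChartedSpace HG G] [Group G]
  {M : Type*} [TopologicalSpace M] [ChartedSpace H M] [MulAction G M]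

variable (I) in
/-- The fundamental vector field `X^*` of `X`, with `X^*_p = d/dt exp(tX) • p` at `t = 0`, that is,
the differential at `1` of `a ↦ a • p` applied to `X`. -/
def fundamentalField (X : GroupLieAlgebra J G) (p : M) : TangentSpace I p :=
  (mfderiv J I (fun a : G => a • p) 1 X : E)

variable (J I G M) in
/-- `M`, with a Riemannian metric, is a homogeneous Riemannian manifold of the Lie group `G`: the
action of `G` is smooth, effective, transitive and by isometries. The orbit maps are submersions,
which says that the smooth structure of `M` is that of the quotient of `G` by an isotropy group. -/
structure IsHomogeneousRiemannian [RiemannianBundle (fun x : M => TangentSpace I x)] : Prop where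
  contMDiff : ContMDiff (J.prod I) I ∞ (fun q : G × M => q.1 • q.2)
  effective : FaithfulSMul G M
  transitive : MulAction.IsPretransitive G M
  submersion : ∀ p : M, Function.Surjective (mfderiv J I (fun a : G => a • p) 1)
  isometric : ∀ (a : G) (p : M) (v w : TangentSpace I p),
    inner ℝ (mfderiv I I (fun x : M => a • x) p v) (mfderiv I I (fun x : M => a • x) p w)
      = inner ℝ v w

end Homogeneous

section Kostant

attribute [local instance 100] LieRing.ofAssociativeRing

/-- The Lie algebra `𝔰𝔬(V)` of skew-symmetric endomorphisms of a Euclidean vector space. -/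
abbrev soLie (V : Type*) [NormedAddCommGroup V] [InnerProductSpace ℝ V] :
    LieSubalgebra ℝ (Module.End ℝ V) :=
  skewAdjointLieSubalgebra (innerₗ V : LinearMap.BilinForm ℝ V)

/-- The trace form `(A, B) ↦ tr (A B)` on `𝔰𝔬(V)`. -/
def soTraceForm (V : Type*) [NormedAddCommGroup V] [InnerProductSpace ℝ V] :
    LinearMap.BilinForm ℝ (soLie V) :=
  LinearMap.mk₂ ℝ (fun A B => LinearMap.trace ℝ V ((A : Module.End ℝ V) * (B : Module.End ℝ V)))
    (by intros; simp [add_mul]) (by intros; simp) (by intros; simp [mul_add]) (by intros; simp)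

/-- The Cartan-Killing metric of `𝔰𝔬(V)`: its Killing form, equal to `(n - 2) tr (A B)` for
`n = dim V`. If `n = 2` the Killing form vanishes identically, and `tr (A B)` takes its place. -/
def cartanKilling (V : Type*) [NormedAddCommGroup V] [InnerProductSpace ℝ V] :
    LinearMap.BilinForm ℝ (soLie V) :=
  if Module.finrank ℝ V = 2 then soTraceForm V else killingForm ℝ (soLie V)

variable {F : Type*} [NormedAddCommGroup F] [NormedSpace ℝ F]
  {HG : Type*} [TopologicalSpace HG] {J : ModelWithCorners ℝ F HG}
  {E : Type*} [NormedAddCommGroup E] [NormedSpace ℝ E] [CompleteSpace E] [FiniteDimensional ℝ E]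
  {H : Type*} [TopologicalSpace H] {I : ModelWithCorners ℝ E H}
  {G : Type*} [TopologicalSpace G] [ChartedSpace HG G] [Group G]
  {M : Type*} [TopologicalSpace M] [ChartedSpace H M] [MulAction G M] [IsManifold I ∞ M]
  [RiemannianBundle (fun x : M => TangentSpace I x)]
  [IsContMDiffRiemannianBundle I ∞ E (fun x : M => TangentSpace I x)]

variable (I) in
/-- The Kostant operator `K_X : T_o M → T_o M`, `v ↦ ∇_v X^*`. -/
def kostantOperator (o : M) (X : GroupLieAlgebra J G) : Module.End ℝ (TangentSpace I o) :=
  haveI : IsContMDiffRiemannianBundle I 1 E (fun x : M => TangentSpace I x) :=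
    IsContMDiffRiemannianBundle.of_le (n := ∞) (by simp)
  (leviCivita (fundamentalField I X) o : TangentSpace I o →ₗ[ℝ] TangentSpace I o)

/-- The form `φ(X, Y) = -𝔅(κ X, κ Y)`, where `𝔅` is the Cartan-Killing metric of `𝔰𝔬(T_o M)`. -/
def kostantForm {o : M} (κ : GroupLieAlgebra J G →ₗ[ℝ] soLie (TangentSpace I o)) :
    LinearMap.BilinForm ℝ (GroupLieAlgebra J G) :=
  -(cartanKilling (TangentSpace I o)).compl₁₂ κ κ

end Kostant

section Orthogonal

/-- `{X ∈ V | φ (X, Y) = 0 for all Y ∈ W}`. -/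
def orthogonalIn {V : Type*} [AddCommGroup V] [Module ℝ V] (φ : LinearMap.BilinForm ℝ V)
    (W : Submodule ℝ V) : Submodule ℝ V where
  carrier := {X | ∀ Y ∈ W, φ X Y = 0}
  zero_mem' := by simp
  add_mem' := by
    intro a b ha hb Y hY
    simp [ha Y hY, hb Y hY]
  smul_mem' := by
    intro c a ha Y hY
    simp [ha Y hY]

end Orthogonal

end

/-! The positivity of `φ` on the isotropy algebra rests on two facts. First, the Cartan-Killing
metric of `𝔰𝔬(V)` is negative definite (`cartanKilling_neg`): `tr (A²)` is minus a sum of squares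
for skew `A`. In dimension at least 3, `ad A` is itself skew for the positive form `-tr`, and the
centre is trivial. Dimension 2 uses the trace form directly, and in lower dimension `𝔰𝔬(V)` is zero.

Second, `X ↦ K_X` is injective on the isotropy algebra (`eq_zero_of_kostantMap_eq_zero`). There
`X^*` vanishes at `o`; if `K_X = 0` as well, torsion-freeness makes the first derivative of `X^*` in
a chart vanish at `o`. A Killing field on a connected manifold is determined by its 1-jet at a point
(`fundamentalField_eq_zero`): differentiating Killing's equation bounds the second derivatives by
the 1-jet, a Grönwall estimate along segments gives local vanishing, and an open-closed argument
globalises it. So `X^* = 0`, and effectiveness gives `X = 0`. Killing's equation also makes `K_X`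
skew, so that `κ` takes values in `𝔰𝔬(T_o M)`.

For the subgroup, the Lie algebra of `H` maps injectively into that of the full isotropy group, so
the pulled-back form is positive on it and the orthogonal is a complement (`isCompl_orthogonalIn`).
An isometry preserves the Levi-Civita connection, so for `a` fixing `o` the operator of `Ad a X` is
the conjugate of `K_X` by the differential of `a`; hence `φ` is invariant (`kostantForm_Ad`). Since
`Ad(H)` preserves the Lie algebra of `H`, it preserves the orthogonal too. -/

noncomputable section

/-! ### Traces of squares of skew endomorphisms -/

section TraceForms

theorem trace_sq_eq_neg_sum_norm_sq {V ι : Type*} [NormedAddCommGroup V] [InnerProductSpace ℝ V]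
    [Fintype ι] (b : OrthonormalBasis ι ℝ V) {S : Module.End ℝ V}
    (hS : ∀ x y, inner ℝ (S x) y = -inner ℝ x (S y)) :
    LinearMap.trace ℝ V (S * S) = -∑ i, ‖S (b i)‖ ^ 2 := by
  rw [LinearMap.trace_eq_sum_inner _ b, ← Finset.sum_neg_distrib]
  refine Finset.sum_congr rfl fun i _ => ?_
  rw [Module.End.mul_apply, ← real_inner_self_eq_norm_sq, hS, neg_neg]

theorem trace_sq_neg_of_skew {V : Type*} [NormedAddCommGroup V] [InnerProductSpace ℝ V]
    [FiniteDimensional ℝ V] {S : Module.End ℝ V}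
    (hS : ∀ x y, inner ℝ (S x) y = -inner ℝ x (S y)) (h0 : S ≠ 0) :
    LinearMap.trace ℝ V (S * S) < 0 := by
  set b := stdOrthonormalBasis ℝ V
  rw [trace_sq_eq_neg_sum_norm_sq b hS, neg_lt_zero]
  refine lt_of_le_of_ne (Finset.sum_nonneg fun i _ => sq_nonneg _) fun h => h0 ?_
  refine b.toBasis.ext fun i => ?_
  have := (Finset.sum_eq_zero_iff_of_nonneg fun i _ => sq_nonneg _).1 h.symm i (Finset.mem_univ i)
  simpa using this

/-- An endomorphism that is skew for a positive definite bilinear form has negative trace square,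
unless it vanishes. -/
theorem trace_sq_neg_of_skew_form {L : Type*} [AddCommGroup L] [Module ℝ L]
    [FiniteDimensional ℝ L] (B : LinearMap.BilinForm ℝ L) (hsymm : ∀ x y, B x y = B y x)
    (hpos : ∀ x, x ≠ 0 → 0 < B x x) {S : Module.End ℝ L}
    (hS : ∀ x y, B (S x) y = -B x (S y)) (h0 : S ≠ 0) :
    LinearMap.trace ℝ L (S * S) < 0 := by
  -- The form `B` itself becomes the inner product, which reduces the claim to the Euclidean case.
  let c : InnerProductSpace.Core ℝ L :=
    { inner := fun x y => B x y
      conj_inner_symm := fun x y => by simp [hsymm x y]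
      re_inner_nonneg := fun x => by
        by_cases hx : x = 0
        · simp [hx]
        · simpa using (hpos x hx).le
      add_left := fun x y z => by simp
      smul_left := fun x y r => by simp
      definite := fun x hx => by
        by_contra h
        exact (hpos x h).ne' hx }
  let : NormedAddCommGroup L := @InnerProductSpace.Core.toNormedAddCommGroup ℝ L _ _ _ c
  let : InnerProductSpace ℝ L := InnerProductSpace.ofCore c.toCore
  exact trace_sq_neg_of_skew (V := L) hS h0

end TraceForms

/-! ### Negative definiteness and invariance of the Cartan-Killing metric -/

section SoLie

attribute [local instance 100] LieRing.ofAssociativeRing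

variable {V : Type*} [NormedAddCommGroup V] [InnerProductSpace ℝ V]

theorem mem_soLie_iff {A : Module.End ℝ V} :
    A ∈ soLie V ↔ ∀ x y, inner ℝ (A x) y = -inner ℝ x (A y) := by
  change A ∈ LinearMap.skewAdjointSubmodule _ ↔ _
  rw [LinearMap.mem_skewAdjointSubmodule]
  constructor
  · intro h x y
    simpa using h x y
  · intro h x y
    simpa using h x y

theorem soLie_inner (A : soLie V) (x y : V) :
    inner ℝ ((A : Module.End ℝ V) x) y = -inner ℝ x ((A : Module.End ℝ V) y) :=
  mem_soLie_iff.1 A.2 x y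

variable [FiniteDimensional ℝ V]

theorem soTraceForm_apply (A B : soLie V) :
    soTraceForm V A B = LinearMap.trace ℝ V ((A : Module.End ℝ V) * (B : Module.End ℝ V)) := rfl

theorem soTraceForm_neg {A : soLie V} (hA : A ≠ 0) : soTraceForm V A A < 0 :=
  trace_sq_neg_of_skew (soLie_inner A) fun h => hA (Subtype.ext h)

theorem soTraceForm_symm (A B : soLie V) : soTraceForm V A B = soTraceForm V B A :=
  LinearMap.trace_mul_comm ℝ _ _

/-- Cyclicity of the trace. This is what makes `ad A` skew for the trace form. -/
theorem soTraceForm_lie (A B C : soLie V) :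
    soTraceForm V ⁅A, B⁆ C = -soTraceForm V B ⁅A, C⁆ := by
  simp only [soTraceForm_apply, LieSubalgebra.coe_bracket, LieRing.of_associative_ring_bracket,
    sub_mul, mul_sub, map_sub]
  have := LinearMap.trace_mul_cycle ℝ (A : Module.End ℝ V) (B : Module.End ℝ V) (C : Module.End ℝ V)
  have h2 := LinearMap.trace_mul_cycle ℝ (B : Module.End ℝ V) (A : Module.End ℝ V) (C : Module.End ℝ V)
  have h3 := LinearMap.trace_mul_cycle ℝ (B : Module.End ℝ V) (C : Module.End ℝ V) (A : Module.End ℝ V)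
  simp only [mul_assoc] at *
  linarith

/-- The elementary skew-symmetric endomorphism `x ↦ ⟨v, x⟩ w - ⟨w, x⟩ v`. -/
def wedge (v w : V) : soLie V :=
  ⟨(innerₗ V v).smulRight w - (innerₗ V w).smulRight v, mem_soLie_iff.2 fun x y => by
    simp [inner_sub_left, inner_sub_right, inner_smul_left, inner_smul_right]
    rw [real_inner_comm x v, real_inner_comm x w]
    ring⟩

theorem wedge_apply (v w x : V) :
    (wedge v w : Module.End ℝ V) x = (inner ℝ v x : ℝ) • w - (inner ℝ w x : ℝ) • v := by
  simp [wedge]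

/-- The centre of `𝔰𝔬(V)` is trivial if `dim V ≥ 3`. -/
theorem soLie_eq_zero_of_ad_eq_zero (hV : 3 ≤ Module.finrank ℝ V) {A : soLie V}
    (hA : ∀ B : soLie V, ⁅A, B⁆ = 0) : A = 0 := by
  have key : ∀ v w : V, ‖v‖ = 1 → inner ℝ w v = 0 →
      (A : Module.End ℝ V) w = -(inner ℝ w ((A : Module.End ℝ V) v) : ℝ) • v := by
    intro v w hv hw
    -- Evaluate the vanishing bracket with `wedge v w` at `v`, which `wedge v w` sends to `w`.
    have h := congrArg (fun B : soLie V => (B : Module.End ℝ V) v) (hA (wedge v w))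
    have hvv : inner ℝ v ((A : Module.End ℝ V) v) = 0 := by
      have := soLie_inner A v v
      rw [real_inner_comm] at this
      linarith
    simp [LieRing.of_associative_ring_bracket, wedge_apply, hv, hw, hvv] at h
    simpa using eq_neg_of_add_eq_zero_left h
  have hne : ∀ w : V, (A : Module.End ℝ V) w = 0 := by
    intro w
    by_contra hAw
    set u := (A : Module.End ℝ V) w
    -- Dimension at least 3 leaves room for `v` orthogonal to both `w` and `u = A w`. By `key`, `u`
    -- is then a multiple of `v`, hence orthogonal to itself.
    obtain ⟨v, hv, hv1⟩ : ∃ v : V, v ∈ (Submodule.span ℝ {w, u})ᗮ ∧ v ≠ 0 := by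
      by_contra! hcon
      have hbot : (Submodule.span ℝ {w, u})ᗮ = ⊥ := (Submodule.eq_bot_iff _).2 hcon
      rw [Submodule.orthogonal_eq_bot_iff] at hbot
      classical
      have h1 := finrank_span_finset_le_card (R := ℝ) ({w, u} : Finset V)
      have h2 : ({w, u} : Finset V).card ≤ 2 := Finset.card_le_two
      rw [Finset.coe_pair, Set.finrank, hbot, finrank_top] at h1
      omega
    have hw : inner ℝ w v = 0 := (Submodule.mem_orthogonal _ _).1 hv w
      (Submodule.subset_span (by simp))
    have hu : inner ℝ u v = 0 := (Submodule.mem_orthogonal _ _).1 hv u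
      (Submodule.subset_span (by simp))
    have h := key (‖v‖⁻¹ • v) w (by simp [norm_smul, hv1]) (by simp [inner_smul_right, hw])
    apply hAw
    have hself : inner ℝ u u = 0 := by
      change (A : Module.End ℝ V) w = _ at h
      nth_rewrite 2 [show u = (A : Module.End ℝ V) w from rfl]
      rw [h, inner_smul_right, inner_smul_right, hu]
      simp
    exact inner_self_eq_zero.1 hself
  exact Subtype.ext (LinearMap.ext hne)

/-- The operator `ad A` is skew for the positive definite form `-tr`, so the trace of its square is
negative unless `ad A = 0`; the trivial centre excludes that case. -/
theorem killingForm_soLie_neg (hV : 3 ≤ Module.finrank ℝ V) {A : soLie V} (hA : A ≠ 0) :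
    killingForm ℝ (soLie V) A A < 0 := by
  rw [killingForm_apply_apply]
  refine trace_sq_neg_of_skew_form (-soTraceForm V) (fun x y => ?_) (fun x hx => ?_)
    (fun x y => ?_) fun h => hA ?_
  · simp [soTraceForm_symm x y]
  · simpa using soTraceForm_neg hx
  · simp [soTraceForm_lie A x y]
  · exact soLie_eq_zero_of_ad_eq_zero hV fun B => by
      simpa using congrArg (fun f : Module.End ℝ (soLie V) => f B) h

/-- Skewness makes `A w` orthogonal to `w`, while both lie on one line. -/
theorem soLie_eq_zero_of_finrank_le_one (hV : Module.finrank ℝ V ≤ 1) (A : soLie V) : A = 0 := by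
  refine Subtype.ext (LinearMap.ext fun w => ?_)
  have h0 := soLie_inner A w w
  rw [real_inner_comm] at h0
  have h0 : inner ℝ w ((A : Module.End ℝ V) w) = 0 := by linarith
  obtain ⟨v, hv⟩ := finrank_le_one_iff.1 hV
  obtain ⟨c, rfl⟩ := hv w
  by_cases hc : c = 0
  · simp [hc]
  obtain ⟨e, he⟩ := hv ((A : Module.End ℝ V) (c • v))
  rw [← he, inner_smul_left, inner_smul_right] at h0
  rw [← he]
  rcases (by simpa [hc] using h0 : e = 0 ∨ v = 0) with h | h <;> simp [h]

/-- The Cartan-Killing metric of `𝔰𝔬(V)` is negative definite. -/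
theorem cartanKilling_neg {A : soLie V} (hA : A ≠ 0) : cartanKilling V A A < 0 := by
  unfold cartanKilling
  split_ifs with h
  · exact soTraceForm_neg hA
  · refine killingForm_soLie_neg ?_ hA
    by_contra hlt
    exact hA (soLie_eq_zero_of_finrank_le_one (by omega) A)

/-- Conjugation of skew-symmetric endomorphisms by a linear isometry. -/
def soLieConj (T : V ≃ₗᵢ[ℝ] V) : soLie V ≃ₗ⁅ℝ⁆ soLie V where
  toFun A := ⟨T.toLinearEquiv.conj A, mem_soLie_iff.2 fun x y => by
    have h := soLie_inner A (T.symm x) (T.symm y)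
    rw [← T.inner_map_map, ← T.inner_map_map (T.symm x)] at h
    simpa [LinearEquiv.conj_apply] using h⟩
  invFun A := ⟨T.symm.toLinearEquiv.conj A, mem_soLie_iff.2 fun x y => by
    have h := soLie_inner A (T x) (T y)
    rw [← T.symm.inner_map_map, ← T.symm.inner_map_map (T x)] at h
    simpa [LinearEquiv.conj_apply] using h⟩
  map_add' A B := Subtype.ext (by simp)
  map_smul' c A := Subtype.ext (by simp)
  map_lie' := fun {A B} => Subtype.ext (by
    ext x
    simp [LinearEquiv.conj_apply, LieRing.of_associative_ring_bracket])
  left_inv A := Subtype.ext (by ext x; simp [LinearEquiv.conj_apply])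
  right_inv A := Subtype.ext (by ext x; simp [LinearEquiv.conj_apply])

theorem coe_soLieConj (T : V ≃ₗᵢ[ℝ] V) (A : soLie V) :
    (soLieConj T A : Module.End ℝ V) = T.toLinearEquiv.conj A := rfl

/-- Traces are invariant under conjugation, and Killing forms under Lie algebra automorphisms. -/
theorem cartanKilling_conj (T : V ≃ₗᵢ[ℝ] V) (A B : soLie V) :
    cartanKilling V (soLieConj T A) (soLieConj T B) = cartanKilling V A B := by
  unfold cartanKilling
  split_ifs with h
  · rw [soTraceForm_apply, soTraceForm_apply, coe_soLieConj, coe_soLieConj,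
      ← LinearMap.trace_conj' ((A : Module.End ℝ V) * (B : Module.End ℝ V)) T.toLinearEquiv]
    congr 1
    ext x
    simp [LinearEquiv.conj_apply]
  · exact LieAlgebra.killingForm_of_equiv_apply (soLieConj T) A B

end SoLie

/-! ### Killing's equation and first-order rigidity in a vector space -/

section KillingEquation

open Filter Topology

variable {E F : Type*} [NormedAddCommGroup E] [NormedSpace ℝ E]
  [NormedAddCommGroup F] [NormedSpace ℝ F]

local instance normedAddCommGroupBilin : NormedAddCommGroup (E →L[ℝ] E →L[ℝ] ℝ) := inferInstance

local instance normedSpaceBilin : NormedSpace ℝ (E →L[ℝ] E →L[ℝ] ℝ) := inferInstance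

local instance normedAddCommGroupTrilin : NormedAddCommGroup (E →L[ℝ] E →L[ℝ] E →L[ℝ] ℝ) :=
  inferInstance

local instance normedSpaceTrilin : NormedSpace ℝ (E →L[ℝ] E →L[ℝ] E →L[ℝ] ℝ) := inferInstance

local instance moduleTrilin : Module ℝ (E →L[ℝ] E →L[ℝ] E →L[ℝ] ℝ) := inferInstance

/-- The infinitesimal generator of a family of isometries of a metric `g` on an open subset of a
vector space satisfies Killing's equation. -/
theorem killing_equation_of_isometric_family {Φ : F × E → E} {g : E → E →L[ℝ] E →L[ℝ] ℝ} {s₀ : F}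
    {x₀ : E} {X : F} {Y : E → E} (hΦ : ContDiffAt ℝ 2 Φ (s₀, x₀))
    (h₀ : ∀ᶠ x in 𝓝 x₀, Φ (s₀, x) = x) (hg : DifferentiableAt ℝ g x₀)
    (hY : ∀ᶠ x in 𝓝 x₀, Y x = fderiv ℝ Φ (s₀, x) (X, 0))
    (hiso : ∀ᶠ s in 𝓝 s₀, ∀ v w, g (Φ (s, x₀)) (fderiv ℝ Φ (s, x₀) (0, v))
      (fderiv ℝ Φ (s, x₀) (0, w)) = g x₀ v w) (v w : E) :
    fderiv ℝ g x₀ (Y x₀) v w + g x₀ (fderiv ℝ Y x₀ v) w + g x₀ v (fderiv ℝ Y x₀ w) = 0 := by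
  set D := fderiv ℝ Φ
  have hD : DifferentiableAt ℝ D (s₀, x₀) :=
    (hΦ.fderiv_right (m := 1) (by norm_num)).differentiableAt (by norm_num)
  set D2 := fderiv ℝ D (s₀, x₀)
  have hΦd : HasFDerivAt Φ (D (s₀, x₀)) (s₀, x₀) :=
    (hΦ.differentiableAt (by norm_num)).hasFDerivAt
  have hΦ0 : Φ (s₀, x₀) = x₀ := h₀.self_of_nhds
  have hid : ∀ u, D (s₀, x₀) (0, u) = u := by
    intro u
    have h1 : HasFDerivAt (fun x => Φ (s₀, x))
        ((D (s₀, x₀)).comp (ContinuousLinearMap.inr ℝ F E)) x₀ :=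
      hΦd.comp x₀ (hasFDerivAt_prodMk_right s₀ x₀)
    have h2 : HasFDerivAt (fun x => Φ (s₀, x)) (ContinuousLinearMap.id ℝ E) x₀ :=
      (hasFDerivAt_id x₀).congr_of_eventuallyEq h₀
    simpa using congrArg (fun L : E →L[ℝ] E => L u) (h1.unique h2)
  -- Symmetry of the mixed second derivative turns the derivative of the generator `Y` into the
  -- parameter derivative of the differential of `Φ`.
  have hsymm : ∀ u : E, D2 (0, u) (X, 0) = D2 (X, 0) (0, u) := fun u =>
    (hΦ.isSymmSndFDerivAt (by simp)).eq _ _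
  have hDY : ∀ u, fderiv ℝ Y x₀ u = D2 (X, 0) (0, u) := by
    intro u
    have h1 : HasFDerivAt (fun x => D (s₀, x))
        (D2.comp (ContinuousLinearMap.inr ℝ F E)) x₀ :=
      hD.hasFDerivAt.comp x₀ (hasFDerivAt_prodMk_right s₀ x₀)
    have h2 := (h1.clm_apply (hasFDerivAt_const ((X, 0) : F × E) x₀)).congr_of_eventuallyEq hY
    rw [h2.fderiv, ← hsymm u]
    simp
  have hDs : HasFDerivAt (fun s => D (s, x₀)) (D2.comp (ContinuousLinearMap.inl ℝ F E)) s₀ :=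
    hD.hasFDerivAt.comp s₀ (hasFDerivAt_prodMk_left s₀ x₀)
  have hΦs : HasFDerivAt (fun s => Φ (s, x₀)) ((D (s₀, x₀)).comp (ContinuousLinearMap.inl ℝ F E))
      s₀ := hΦd.comp s₀ (hasFDerivAt_prodMk_left s₀ x₀)
  have hgs : HasFDerivAt (fun s => g (Φ (s, x₀)))
      ((fderiv ℝ g x₀).comp ((D (s₀, x₀)).comp (ContinuousLinearMap.inl ℝ F E))) s₀ := by
    have hg' : HasFDerivAt g (fderiv ℝ g x₀) (Φ (s₀, x₀)) := by rw [hΦ0]; exact hg.hasFDerivAt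
    exact hg'.comp s₀ hΦs
  have hv := hDs.clm_apply (hasFDerivAt_const ((0, v) : F × E) s₀)
  have hw := hDs.clm_apply (hasFDerivAt_const ((0, w) : F × E) s₀)
  -- Differentiate the isometry identity in the parameter, in the direction `X`: the product rule
  -- yields the three terms of Killing's equation, and the other side is constant.
  have hall := (hgs.clm_apply hv).clm_apply hw
  have hconst := (hasFDerivAt_const (𝕜 := ℝ) (g x₀ v w) s₀).congr_of_eventuallyEq
    (hiso.mono fun s hs => hs v w)
  have := congrArg (fun L : F →L[ℝ] ℝ => L X) (hall.unique hconst)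
  simp [hid, hΦ0] at this
  rw [hY.self_of_nhds, hDY, hDY]
  linarith

/-- Killing's equation expresses the second derivatives of a Killing field through its first
derivatives. -/
theorem norm_fderiv_fderiv_le_of_killing_equation {g : E → E →L[ℝ] E →L[ℝ] ℝ} {Y : E → E} {x : E}
    (hg : ContDiffAt ℝ 2 g x) (hY : ContDiffAt ℝ 2 Y x)
    (hsymm : ∀ v w, g x v w = g x w v) {c : ℝ} (hc : 0 < c)
    (hpos : ∀ w, c * ‖w‖ ^ 2 ≤ g x w w)
    (hK : ∀ᶠ y in 𝓝 x, ∀ v w, fderiv ℝ g y (Y y) v w + g y (fderiv ℝ Y y v) w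
      + g y v (fderiv ℝ Y y w) = 0) {C₁ C₂ : ℝ} (h₁ : ‖fderiv ℝ g x‖ ≤ C₁)
    (h₂ : ‖fderiv ℝ (fderiv ℝ g) x‖ ≤ C₂) :
    ‖fderiv ℝ (fderiv ℝ Y) x‖ ≤ 3 * (C₂ + 3 * C₁) / (2 * c) * ‖(Y x, fderiv ℝ Y x)‖ := by
  set m := ‖(Y x, fderiv ℝ Y x)‖
  have hm : 0 ≤ m := norm_nonneg _
  have hm₁ : ‖Y x‖ ≤ m := norm_fst_le (Y x, fderiv ℝ Y x)
  have hm₂ : ‖fderiv ℝ Y x‖ ≤ m := norm_snd_le (Y x, fderiv ℝ Y x)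
  have hC₁ : 0 ≤ C₁ := (norm_nonneg _).trans h₁
  have hC₂ : 0 ≤ C₂ := (norm_nonneg _).trans h₂
  set C := C₂ + 3 * C₁ with hC
  set g' := fderiv ℝ g x
  set g'' := fderiv ℝ (fderiv ℝ g) x
  set Y' := fderiv ℝ Y x
  set Y'' := fderiv ℝ (fderiv ℝ Y) x
  have hgd : HasFDerivAt g g' x := (hg.differentiableAt (by norm_num)).hasFDerivAt
  have hYd : HasFDerivAt Y Y' x := (hY.differentiableAt (by norm_num)).hasFDerivAt
  have hgdd : HasFDerivAt (fderiv ℝ g) g'' x :=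
    ((hg.fderiv_right (m := 1) (by norm_num)).differentiableAt (by norm_num)).hasFDerivAt
  have hYdd : HasFDerivAt (fderiv ℝ Y) Y'' x :=
    ((hY.fderiv_right (m := 1) (by norm_num)).differentiableAt (by norm_num)).hasFDerivAt
  have hYsymm : ∀ u v, Y'' u v = Y'' v u := fun u v =>
    (hY.isSymmSndFDerivAt (by simp)).eq _ _
  -- Killing's equation differentiated in the direction `u`: the right side involves only the 1-jet
  -- of `Y`. Its one `g''` term and three `g'` terms account for `C = C₂ + 3 * C₁`.
  have hderiv : ∀ u v w, g x (Y'' u v) w + g x (Y'' u w) v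
      = -(g'' u (Y x) v w + g' (Y' u) v w + g' u (Y' v) w + g' u v (Y' w)) := by
    intro u v w
    have e1 := ((hgdd.clm_apply hYd).clm_apply (hasFDerivAt_const v x)).clm_apply
      (hasFDerivAt_const w x)
    have e2 := (hgd.clm_apply (hYdd.clm_apply (hasFDerivAt_const v x))).clm_apply
      (hasFDerivAt_const w x)
    have e3 := (hgd.clm_apply (hasFDerivAt_const v x)).clm_apply
      (hYdd.clm_apply (hasFDerivAt_const w x))
    have hconst := (hasFDerivAt_const (𝕜 := ℝ) (0 : ℝ) x).congr_of_eventuallyEq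
      (hK.mono fun y hy => hy v w)
    have := congrArg (fun L : E →L[ℝ] ℝ => L u) (((e1.add e2).add e3).unique hconst)
    simp at this
    rw [hsymm (Y'' u w) v]
    linarith
  have hbound : ∀ u v w, |g x (Y'' u v) w + g x (Y'' u w) v| ≤ C * m * (‖u‖ * ‖v‖ * ‖w‖) := by
    intro u v w
    rw [hderiv, abs_neg]
    have b1 : |g'' u (Y x) v w| ≤ C₂ * m * (‖u‖ * ‖v‖ * ‖w‖) := by
      calc |g'' u (Y x) v w| ≤ ‖g'' u (Y x)‖ * ‖v‖ * ‖w‖ := (g'' u (Y x)).le_opNorm₂ v w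
        _ ≤ (‖g''‖ * ‖u‖ * ‖Y x‖) * ‖v‖ * ‖w‖ := by gcongr; exact g''.le_opNorm₂ u (Y x)
        _ ≤ (C₂ * ‖u‖ * m) * ‖v‖ * ‖w‖ := by gcongr
        _ = _ := by ring
    have b2 : ∀ p q r : E, |g' p q r| ≤ C₁ * ‖p‖ * ‖q‖ * ‖r‖ := fun p q r => by
      calc |g' p q r| ≤ ‖g' p‖ * ‖q‖ * ‖r‖ := (g' p).le_opNorm₂ q r
        _ ≤ (C₁ * ‖p‖) * ‖q‖ * ‖r‖ := by gcongr; exact g'.le_of_opNorm_le h₁ p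
    have b3 : ∀ p, ‖Y' p‖ ≤ m * ‖p‖ := fun p => Y'.le_of_opNorm_le hm₂ p
    have c1 : |g' (Y' u) v w| ≤ C₁ * m * (‖u‖ * ‖v‖ * ‖w‖) := (b2 _ _ _).trans <| by
      calc C₁ * ‖Y' u‖ * ‖v‖ * ‖w‖ ≤ C₁ * (m * ‖u‖) * ‖v‖ * ‖w‖ := by gcongr; exact b3 u
        _ = _ := by ring
    have c2 : |g' u (Y' v) w| ≤ C₁ * m * (‖u‖ * ‖v‖ * ‖w‖) := (b2 _ _ _).trans <| by
      calc C₁ * ‖u‖ * ‖Y' v‖ * ‖w‖ ≤ C₁ * ‖u‖ * (m * ‖v‖) * ‖w‖ := by gcongr; exact b3 v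
        _ = _ := by ring
    have c3 : |g' u v (Y' w)| ≤ C₁ * m * (‖u‖ * ‖v‖ * ‖w‖) := (b2 _ _ _).trans <| by
      calc C₁ * ‖u‖ * ‖v‖ * ‖Y' w‖ ≤ C₁ * ‖u‖ * ‖v‖ * (m * ‖w‖) := by gcongr; exact b3 w
        _ = _ := by ring
    calc _ ≤ |g'' u (Y x) v w| + |g' (Y' u) v w| + |g' u (Y' v) w| + |g' u v (Y' w)| :=
          (abs_add_le _ _).trans <| add_le_add_left ((abs_add_le _ _).trans <|
            add_le_add_left (abs_add_le _ _) _) _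
      _ ≤ C * m * (‖u‖ * ‖v‖ * ‖w‖) := by rw [hC]; linarith
  -- The permutation trick behind the Christoffel symbols: add two cyclic variants of the bounded
  -- expression, subtract the third, and use the symmetry of `Y''` to isolate a single term.
  have hmain : ∀ u v w, 2 * g x (Y'' u v) w ≤ 3 * (C * m * (‖u‖ * ‖v‖ * ‖w‖)) := by
    intro u v w
    have a1 := (abs_le.1 (hbound u v w)).2
    have a2 := (abs_le.1 (hbound v u w)).2
    have a3 := (abs_le.1 (hbound w u v)).1
    rw [hYsymm v u] at a2
    rw [hYsymm w u, hYsymm w v] at a3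
    have r1 : ‖v‖ * ‖u‖ * ‖w‖ = ‖u‖ * ‖v‖ * ‖w‖ := by ring
    have r2 : ‖w‖ * ‖u‖ * ‖v‖ = ‖u‖ * ‖v‖ * ‖w‖ := by ring
    rw [r1] at a2
    rw [r2] at a3
    linarith
  refine ContinuousLinearMap.opNorm_le_bound₂ _ (by positivity) fun u v => ?_
  -- Testing against `w = Y'' u v` brings in definiteness of `g`; one factor `‖w‖` then cancels.
  set w := Y'' u v
  rcases eq_or_ne w 0 with hw | hw
  · rw [hw, norm_zero]; positivity
  have hwpos : 0 < ‖w‖ := norm_pos_iff.2 hw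
  have h3 := hmain u v w
  have h4 := hpos w
  have h5 : (2 * c * ‖w‖) * ‖w‖ ≤ (3 * C * m * ‖u‖ * ‖v‖) * ‖w‖ := by nlinarith
  have h6 := le_of_mul_le_mul_right h5 hwpos
  calc ‖w‖ = (2 * c * ‖w‖) / (2 * c) := by field_simp
    _ ≤ (3 * C * m * ‖u‖ * ‖v‖) / (2 * c) := by gcongr
    _ = _ := by ring

/-- A Killing field on an open subset of a vector space vanishes near every point where it vanishes
to first order. -/
theorem eventually_eq_zero_of_killing_equation {g : E → E →L[ℝ] E →L[ℝ] ℝ} {Y : E → E} {x₀ : E}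
    (hg : ContDiffAt ℝ 2 g x₀) (hY : ContDiffAt ℝ 2 Y x₀)
    (hsymm : ∀ᶠ x in 𝓝 x₀, ∀ v w, g x v w = g x w v) {c : ℝ} (hc : 0 < c)
    (hpos : ∀ᶠ x in 𝓝 x₀, ∀ w, c * ‖w‖ ^ 2 ≤ g x w w)
    (hK : ∀ᶠ x in 𝓝 x₀, ∀ v w, fderiv ℝ g x (Y x) v w + g x (fderiv ℝ Y x v) w
      + g x v (fderiv ℝ Y x w) = 0) (h₀ : Y x₀ = 0) (h₁ : fderiv ℝ Y x₀ = 0) :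
    ∀ᶠ x in 𝓝 x₀, Y x = 0 := by
  have hg' : ContDiffAt ℝ 1 (fderiv ℝ g) x₀ := hg.fderiv_right (by norm_num)
  have hg'' : ContDiffAt ℝ 0 (fderiv ℝ (fderiv ℝ g)) x₀ := hg'.fderiv_right (by norm_num)
  set C₁ := ‖fderiv ℝ g x₀‖ + 1
  set C₂ := ‖fderiv ℝ (fderiv ℝ g) x₀‖ + 1
  have e₁ : ∀ᶠ x in 𝓝 x₀, ‖fderiv ℝ g x‖ < C₁ :=
    hg'.continuousAt.norm.eventually_lt_const (lt_add_one _)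
  have e₂ : ∀ᶠ x in 𝓝 x₀, ‖fderiv ℝ (fderiv ℝ g) x‖ < C₂ :=
    hg''.continuousAt.norm.eventually_lt_const (lt_add_one _)
  set K := 3 * (C₂ + 3 * C₁) / (2 * c)
  have hgood : ∀ᶠ x in 𝓝 x₀, ContDiffAt ℝ 2 Y x ∧
      ‖fderiv ℝ (fderiv ℝ Y) x‖ ≤ K * ‖(Y x, fderiv ℝ Y x)‖ := by
    filter_upwards [hg.eventually (by simp), hY.eventually (by simp), hsymm, hpos,
      hK.eventually_nhds, e₁, e₂] with x a1 a2 a3 a4 a5 a6 a7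
    exact ⟨a2, norm_fderiv_fderiv_le_of_killing_equation a1 a2 a3 hc a4 a5 a6.le a7.le⟩
  obtain ⟨r, hr, hball⟩ := Metric.eventually_nhds_iff_ball.1 hgood
  filter_upwards [Metric.ball_mem_nhds x₀ hr] with x hx
  set h := x - x₀
  have hmem : ∀ t ∈ Set.Icc (0 : ℝ) 1, x₀ + t • h ∈ Metric.ball x₀ r := by
    intro t ht
    rw [mem_ball_iff_norm] at hx ⊢
    rw [add_sub_cancel_left, norm_smul, Real.norm_of_nonneg ht.1]
    exact (mul_le_of_le_one_left (norm_nonneg _) ht.2).trans_lt hx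
  have hline : ∀ t : ℝ, HasDerivAt (fun t : ℝ => x₀ + t • h) h t := fun t => by
    simpa using ((hasDerivAt_id t).smul_const h).const_add x₀
  have hder : ∀ t ∈ Set.Icc (0 : ℝ) 1,
      HasDerivAt (fun t : ℝ => (Y (x₀ + t • h), fderiv ℝ Y (x₀ + t • h)))
        (fderiv ℝ Y (x₀ + t • h) h, fderiv ℝ (fderiv ℝ Y) (x₀ + t • h) h) t := by
    intro t ht
    have hc2 := (hball _ (hmem t ht)).1
    exact ((hc2.differentiableAt (by norm_num)).hasFDerivAt.comp_hasDerivAt t (hline t)).prodMk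
      (((hc2.fderiv_right (m := 1) (by norm_num)).differentiableAt
        (by norm_num)).hasFDerivAt.comp_hasDerivAt t (hline t))
  -- Grönwall for the 1-jet along the segment from `x₀` to `x`. The value component has derivative
  -- bounded by `m * ‖h‖` and the derivative component by `K * m * ‖h‖`, whence `max 1 K`.
  have hzero := eq_zero_of_abs_deriv_le_mul_abs_self_of_eq_zero_right
    (K := max 1 K * ‖h‖)
    (fun t ht => (hder t ht).continuousAt.continuousWithinAt)
    (fun t ht => (hder t ⟨ht.1, ht.2.le⟩).hasDerivWithinAt) (by simp [h₀, h₁]) (fun t ht => ?_)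
    1 (by simp)
  · simpa [h] using congrArg Prod.fst hzero
  · have ht' : t ∈ Set.Icc (0 : ℝ) 1 := ⟨ht.1, ht.2.le⟩
    set y := x₀ + t • h
    set m := ‖(Y y, fderiv ℝ Y y)‖
    have hm₂ : ‖fderiv ℝ Y y‖ ≤ m := norm_snd_le (Y y, fderiv ℝ Y y)
    rw [Prod.norm_mk]
    refine max_le ?_ ?_
    · calc ‖fderiv ℝ Y y h‖ ≤ m * ‖h‖ := (fderiv ℝ Y y).le_of_opNorm_le hm₂ h
        _ ≤ max 1 K * m * ‖h‖ := by
          gcongr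
          exact le_mul_of_one_le_left (norm_nonneg _) (le_max_left _ _)
        _ = _ := by ring
    · calc ‖fderiv ℝ (fderiv ℝ Y) y h‖ ≤ (K * m) * ‖h‖ :=
          ContinuousLinearMap.le_of_opNorm_le _ (hball _ (hmem t ht')).2 h
        _ ≤ max 1 K * m * ‖h‖ := by
          gcongr
          exact le_max_right _ _
        _ = _ := by ring

end KillingEquation

/-! ### The metric and vector fields in a chart -/

section ChartMetric

open Filter Topology

variable {E : Type*} [NormedAddCommGroup E] [NormedSpace ℝ E] [FiniteDimensional ℝ E]
  {M : Type*} [TopologicalSpace M] [ChartedSpace E M] [IsManifold 𝓘(ℝ, E) ∞ M]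

/-- The vector field on a chart domain that is constant in the chart. -/
def chartFrame (p : M) (v : E) (q : M) : TangentSpace 𝓘(ℝ, E) q :=
  (trivializationAt E (TangentSpace 𝓘(ℝ, E)) p).symmL ℝ q v

theorem contMDiffOn_chartFrame (p : M) (v : E) :
    CMDiff[(chartAt E p).source] ∞ (T% (chartFrame p v)) := by
  intro q hq
  rw [(trivializationAt E (TangentSpace 𝓘(ℝ, E)) p).contMDiffWithinAt_section _ hq]
  have : CMDiff[(chartAt E p).source] ∞ (fun _ : M => v) := contMDiffOn_const
  refine (this.congr fun y hy => ?_) q hq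
  rw [chartFrame, Trivialization.symmL_apply _ hy]
  exact congrArg Prod.snd ((trivializationAt E (TangentSpace 𝓘(ℝ, E)) p).apply_mk_symm hy v)

theorem contMDiffAt_chartFrame (p : M) (v : E) :
    CMDiffAt ∞ (T% (chartFrame p v)) p :=
  (contMDiffOn_chartFrame p v).contMDiffAt
    ((chartAt E p).open_source.mem_nhds (mem_chart_source E p))

theorem mdifferentiableAt_chartFrame (p : M) (v : E) : MDiffAt (T% (chartFrame p v)) p :=
  (contMDiffAt_chartFrame p v).mdifferentiableAt (by simp)

/-- The expression of a vector field in a chart. -/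
def chartField (p : M) (Y : Π q : M, TangentSpace 𝓘(ℝ, E) q) (x : E) : E :=
  (trivializationAt E (TangentSpace 𝓘(ℝ, E)) p).continuousLinearMapAt ℝ
    ((extChartAt 𝓘(ℝ, E) p).symm x) (Y ((extChartAt 𝓘(ℝ, E) p).symm x))

theorem contDiffOn_chartField (p : M) {Y : Π q : M, TangentSpace 𝓘(ℝ, E) q}
    (hY : CMDiff ∞ (T% Y)) : ContDiffOn ℝ ∞ (chartField p Y) (extChartAt 𝓘(ℝ, E) p).target := by
  rw [← contMDiffOn_iff_contDiffOn]
  have h1 : CMDiff[(chartAt E p).source] ∞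
      (fun q => (trivializationAt E (TangentSpace 𝓘(ℝ, E)) p (T% Y q)).2) := by
    intro q hq
    rw [← (trivializationAt E (TangentSpace 𝓘(ℝ, E)) p).contMDiffWithinAt_section _ hq]
    exact (hY q).contMDiffWithinAt
  have h2 := h1.comp (contMDiffOn_extChartAt_symm (I := 𝓘(ℝ, E)) (n := ∞) p) (fun x hx => by
    rw [← extChartAt_source 𝓘(ℝ, E)]; exact (extChartAt 𝓘(ℝ, E) p).map_target hx)
  refine h2.congr fun x hx => ?_
  have hmem : (extChartAt 𝓘(ℝ, E) p).symm x ∈ (chartAt E p).source := by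
    rw [← extChartAt_source 𝓘(ℝ, E)]; exact (extChartAt 𝓘(ℝ, E) p).map_target hx
  simp only [chartField, Function.comp_apply, Trivialization.continuousLinearMapAt_apply]
  rw [Trivialization.coe_linearMapAt_of_mem _ hmem]

variable [RiemannianBundle (fun x : M => TangentSpace 𝓘(ℝ, E) x)]

/-- The metric at a point of a chart domain, read in the chart. -/
def frameMetric (p q : M) : E →L[ℝ] E →L[ℝ] ℝ :=
  (innerSL ℝ (E := TangentSpace 𝓘(ℝ, E) q)).bilinearComp
    ((trivializationAt E (TangentSpace 𝓘(ℝ, E)) p).symmL ℝ q)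
    ((trivializationAt E (TangentSpace 𝓘(ℝ, E)) p).symmL ℝ q)

theorem frameMetric_apply (p q : M) (v w : E) :
    frameMetric p q v w = inner ℝ (chartFrame p v q) (chartFrame p w q) := rfl

theorem frameMetric_continuousLinearMapAt {p q : M} (hq : q ∈ (chartAt E p).source)
    (v w : TangentSpace 𝓘(ℝ, E) q) :
    frameMetric p q
      ((trivializationAt E (TangentSpace 𝓘(ℝ, E)) p).continuousLinearMapAt ℝ q v)
      ((trivializationAt E (TangentSpace 𝓘(ℝ, E)) p).continuousLinearMapAt ℝ q w)
      = inner ℝ v w := by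
  rw [frameMetric_apply, chartFrame, chartFrame, Trivialization.symmL_continuousLinearMapAt _ hq,
    Trivialization.symmL_continuousLinearMapAt _ hq]

/-- The metric of a Riemannian manifold, read in a chart. -/
def chartMetric (p : M) (x : E) : E →L[ℝ] E →L[ℝ] ℝ :=
  frameMetric p ((extChartAt 𝓘(ℝ, E) p).symm x)

theorem chartMetric_symm (p : M) (x v w : E) : chartMetric p x v w = chartMetric p x w v :=
  real_inner_comm (chartFrame p w ((extChartAt 𝓘(ℝ, E) p).symm x))
    (chartFrame p v ((extChartAt 𝓘(ℝ, E) p).symm x))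

variable [IsContMDiffRiemannianBundle 𝓘(ℝ, E) ∞ E (fun x : M => TangentSpace 𝓘(ℝ, E) x)]

theorem contMDiffOn_frameMetric_apply (p : M) (v w : E) :
    CMDiff[(chartAt E p).source] ∞ (fun q => frameMetric p q v w) :=
  ContMDiffOn.inner_bundle (IB := 𝓘(ℝ, E)) (F := E) (E := fun x : M => TangentSpace 𝓘(ℝ, E) x)
    (b := fun x => x) (contMDiffOn_chartFrame p v) (contMDiffOn_chartFrame p w)

theorem contDiffOn_chartMetric (p : M) :
    ContDiffOn ℝ ∞ (chartMetric p) (extChartAt 𝓘(ℝ, E) p).target := by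
  refine contDiffOn_clm_apply.2 fun v => contDiffOn_clm_apply.2 fun w => ?_
  rw [← contMDiffOn_iff_contDiffOn]
  exact (contMDiffOn_frameMetric_apply p v w).comp
    (contMDiffOn_extChartAt_symm (I := 𝓘(ℝ, E)) (n := ∞) p) (fun x hx => by
    rw [← extChartAt_source 𝓘(ℝ, E)]; exact (extChartAt 𝓘(ℝ, E) p).map_target hx)

/-- By continuity of the metric, the trivialisation has operator norm below some `C` near `p`; then
`C⁻²` is a locally uniform lower bound. -/
theorem exists_le_chartMetric (p : M) :
    ∃ c : ℝ, 0 < c ∧ ∀ᶠ x in 𝓝 (extChartAt 𝓘(ℝ, E) p p),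
      ∀ w, c * ‖w‖ ^ 2 ≤ chartMetric p x w w := by
  obtain ⟨g, hg, hg'⟩ := IsContMDiffRiemannianBundle.exists_contMDiff (IB := 𝓘(ℝ, E)) (n := ∞)
    (F := E) (E := fun x : M => TangentSpace 𝓘(ℝ, E) x)
  have : IsContinuousRiemannianBundle E (fun x : M => TangentSpace 𝓘(ℝ, E) x) :=
    ⟨⟨g, hg.continuous, hg'⟩⟩
  obtain ⟨C, hC, hev⟩ := eventually_norm_trivializationAt_lt E
    (fun x : M => TangentSpace 𝓘(ℝ, E) x) p
  refine ⟨(C ^ 2)⁻¹, by positivity, ?_⟩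
  have hcont : Tendsto (extChartAt 𝓘(ℝ, E) p).symm (𝓝 (extChartAt 𝓘(ℝ, E) p p)) (𝓝 p) := by
    have := continuousAt_extChartAt_symm (I := 𝓘(ℝ, E)) p
    rwa [ContinuousAt, extChartAt_to_inv] at this
  filter_upwards [hcont.eventually hev, hcont.eventually
    ((chartAt E p).open_source.mem_nhds (mem_chart_source E p))] with x hx hmem w
  set q := (extChartAt 𝓘(ℝ, E) p).symm x
  have h1 : (trivializationAt E (TangentSpace 𝓘(ℝ, E)) p).continuousLinearMapAt ℝ q
      (chartFrame p w q) = w := Trivialization.continuousLinearMapAt_symmL _ hmem w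
  have h2 : ‖w‖ ≤ C * ‖chartFrame p w q‖ := by
    rw [← h1]
    refine (ContinuousLinearMap.le_of_opNorm_le _ hx.le _).trans_eq ?_
    rw [h1]
  have h3 : chartMetric p x w w = ‖chartFrame p w q‖ ^ 2 :=
    real_inner_self_eq_norm_sq (chartFrame p w q)
  rw [h3, inv_mul_le_iff₀ (by positivity), ← mul_pow]
  gcongr

end ChartMetric

/-! ### Fundamental fields are Killing fields, determined by their 1-jet -/

section FundamentalFields

open Filter Topology

variable {F : Type*} [NormedAddCommGroup F] [NormedSpace ℝ F]
  {E : Type*} [NormedAddCommGroup E] [NormedSpace ℝ E]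
  {G : Type*} [TopologicalSpace G] [ChartedSpace F G] [Group G]
  {M : Type*} [TopologicalSpace M] [ChartedSpace E M] [MulAction G M]

theorem two_le_infty : (2 : WithTop ℕ∞) ≤ ∞ := ENat.LEInfty.out

theorem fundamentalField_add (X Y : GroupLieAlgebra 𝓘(ℝ, F) G) :
    (fundamentalField 𝓘(ℝ, E) (X + Y) : Π p : M, TangentSpace 𝓘(ℝ, E) p)
      = fundamentalField 𝓘(ℝ, E) X + fundamentalField 𝓘(ℝ, E) Y := by
  ext1 p
  exact map_add (mfderiv 𝓘(ℝ, F) 𝓘(ℝ, E) (fun a : G => a • p) 1) X Y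

theorem fundamentalField_smul (c : ℝ) (X : GroupLieAlgebra 𝓘(ℝ, F) G) :
    (fundamentalField 𝓘(ℝ, E) (c • X) : Π p : M, TangentSpace 𝓘(ℝ, E) p)
      = c • fundamentalField 𝓘(ℝ, E) X := by
  ext1 p
  exact map_smul (mfderiv 𝓘(ℝ, F) 𝓘(ℝ, E) (fun a : G => a • p) 1) c X

variable [IsManifold 𝓘(ℝ, E) ∞ M] [IsManifold 𝓘(ℝ, F) ∞ G]

theorem contMDiff_smul_left
    (hact : ContMDiff (𝓘(ℝ, F).prod 𝓘(ℝ, E)) 𝓘(ℝ, E) ∞ (fun q : G × M => q.1 • q.2))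
    (a : G) : CMDiff ∞ (fun p : M => a • p) :=
  hact.comp (contMDiff_const.prodMk contMDiff_id)

theorem contMDiff_smul_right
    (hact : ContMDiff (𝓘(ℝ, F).prod 𝓘(ℝ, E)) 𝓘(ℝ, E) ∞ (fun q : G × M => q.1 • q.2))
    (p : M) : CMDiff ∞ (fun a : G => a • p) :=
  hact.comp (contMDiff_id.prodMk contMDiff_const)

/-- The field is the tangent map of the action evaluated on `X` at `1` and the zero vector at `p`, a
composition of smooth maps. -/
theorem contMDiff_fundamentalField
    (hact : ContMDiff (𝓘(ℝ, F).prod 𝓘(ℝ, E)) 𝓘(ℝ, E) ∞ (fun q : G × M => q.1 • q.2))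
    (X : GroupLieAlgebra 𝓘(ℝ, F) G) :
    CMDiff ∞ (T% (fundamentalField 𝓘(ℝ, E) X : Π p : M, TangentSpace 𝓘(ℝ, E) p)) := by
  let f₀ : M → TangentBundle 𝓘(ℝ, E) M := fun p => TotalSpace.mk' E p 0
  have s₀ : CMDiff ∞ f₀ := contMDiff_zeroSection _ _
  let f₁ : M → TangentBundle 𝓘(ℝ, F) G := fun _ => TotalSpace.mk' F 1 X
  have s₁ : CMDiff ∞ f₁ := contMDiff_const
  let F₂ : (TangentBundle 𝓘(ℝ, F) G × TangentBundle 𝓘(ℝ, E) M) →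
      TangentBundle (𝓘(ℝ, F).prod 𝓘(ℝ, E)) (G × M) :=
    (equivTangentBundleProd 𝓘(ℝ, F) G 𝓘(ℝ, E) M).symm
  have s₂ : CMDiff ∞ F₂ := contMDiff_equivTangentBundleProd_symm
  let F₃ : TangentBundle (𝓘(ℝ, F).prod 𝓘(ℝ, E)) (G × M) → TangentBundle 𝓘(ℝ, E) M :=
    tangentMap (𝓘(ℝ, F).prod 𝓘(ℝ, E)) 𝓘(ℝ, E) (fun q : G × M => q.1 • q.2)
  have s₃ : CMDiff ∞ F₃ := hact.contMDiff_tangentMap (m := ∞) (by simp)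
  have s := (s₃.comp s₂).comp (s₁.prodMk s₀)
  convert! s with p
  · simp [F₂, F₃, f₀, f₁]
  · simp only [Function.comp_apply, tangentMap, F₃, F₂, f₀, f₁]
    rw [mfderiv_prod_eq_add_apply (hact.mdifferentiableAt (by simp))]
    change _ = mfderiv 𝓘(ℝ, F) 𝓘(ℝ, E) (fun z : G => z • p) 1 X
      + mfderiv 𝓘(ℝ, E) 𝓘(ℝ, E) (fun z : M => (1 : G) • z) p 0
    rw [map_zero, add_zero]
    rfl

/-- A group action read in charts at `1` and at `p`. -/
def chartAction (F G : Type*) [NormedAddCommGroup F] [NormedSpace ℝ F] [TopologicalSpace G]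
    [ChartedSpace F G] [Group G] [MulAction G M] (p : M) (z : F × E) : E :=
  extChartAt 𝓘(ℝ, E) p ((extChartAt 𝓘(ℝ, F) (1 : G)).symm z.1 • (extChartAt 𝓘(ℝ, E) p).symm z.2)

theorem extChartAt_symm_mem_source {p : M} {x : E} (hx : x ∈ (extChartAt 𝓘(ℝ, E) p).target) :
    (extChartAt 𝓘(ℝ, E) p).symm x ∈ (chartAt E p).source := by
  rw [← extChartAt_source 𝓘(ℝ, E)]
  exact (extChartAt 𝓘(ℝ, E) p).map_target hx

theorem contMDiffAt_extChartAt_symm {p : M} {x : E} (hx : x ∈ (extChartAt 𝓘(ℝ, E) p).target) :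
    CMDiffAt ∞ (extChartAt 𝓘(ℝ, E) p).symm x :=
  (contMDiffOn_extChartAt_symm p).contMDiffAt ((isOpen_extChartAt_target p).mem_nhds hx)

theorem contDiffAt_chartAction
    (hact : ContMDiff (𝓘(ℝ, F).prod 𝓘(ℝ, E)) 𝓘(ℝ, E) ∞ (fun q : G × M => q.1 • q.2))
    {p : M} {s : F} {x : E} (hs : s ∈ (extChartAt 𝓘(ℝ, F) (1 : G)).target)
    (hx : x ∈ (extChartAt 𝓘(ℝ, E) p).target)
    (hsx : (extChartAt 𝓘(ℝ, F) (1 : G)).symm s • (extChartAt 𝓘(ℝ, E) p).symm x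
      ∈ (chartAt E p).source) :
    ContDiffAt ℝ ∞ (chartAction F G p) (s, x) := by
  rw [← contMDiffAt_iff_contDiffAt, modelWithCornersSelf_prod, ← chartedSpaceSelf_prod]
  have h1 : ContMDiffAt (𝓘(ℝ, F).prod 𝓘(ℝ, E)) (𝓘(ℝ, F).prod 𝓘(ℝ, E)) ∞
      (Prod.map (extChartAt 𝓘(ℝ, F) (1 : G)).symm (extChartAt 𝓘(ℝ, E) p).symm) (s, x) :=
    (contMDiffAt_extChartAt_symm hs).prodMap (contMDiffAt_extChartAt_symm hx)
  have h2 := (contMDiffAt_extChartAt' (I := 𝓘(ℝ, E)) (n := ∞) hsx).comp (s, x)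
    (hact.contMDiffAt.comp (s, x) h1)
  exact h2

/-- Expresses the spatial derivative through the differential of `a • ·`, so that `hM.isometric`
supplies the isometry hypothesis of `killing_equation_of_isometric_family`. -/
theorem fderiv_chartAction_right
    (hact : ContMDiff (𝓘(ℝ, F).prod 𝓘(ℝ, E)) 𝓘(ℝ, E) ∞ (fun q : G × M => q.1 • q.2))
    {p : M} {s : F} {x : E} (hs : s ∈ (extChartAt 𝓘(ℝ, F) (1 : G)).target)
    (hx : x ∈ (extChartAt 𝓘(ℝ, E) p).target)
    (hsx : (extChartAt 𝓘(ℝ, F) (1 : G)).symm s • (extChartAt 𝓘(ℝ, E) p).symm x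
      ∈ (chartAt E p).source) (v : E) :
    fderiv ℝ (chartAction F G p) (s, x) (0, v)
      = (trivializationAt E (TangentSpace 𝓘(ℝ, E)) p).continuousLinearMapAt ℝ
        ((extChartAt 𝓘(ℝ, F) (1 : G)).symm s • (extChartAt 𝓘(ℝ, E) p).symm x)
        (mfderiv 𝓘(ℝ, E) 𝓘(ℝ, E) (fun q : M => (extChartAt 𝓘(ℝ, F) (1 : G)).symm s • q)
          ((extChartAt 𝓘(ℝ, E) p).symm x) (chartFrame p v ((extChartAt 𝓘(ℝ, E) p).symm x))) := by
  set a := (extChartAt 𝓘(ℝ, F) (1 : G)).symm s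
  set q := (extChartAt 𝓘(ℝ, E) p).symm x
  have hq : q ∈ (chartAt E p).source := extChartAt_symm_mem_source hx
  have h1 : HasFDerivAt (fun y => chartAction F G p (s, y))
      ((fderiv ℝ (chartAction F G p) (s, x)).comp (ContinuousLinearMap.inr ℝ F E)) x :=
    ((contDiffAt_chartAction hact hs hx hsx).differentiableAt (by simp)).hasFDerivAt.comp x
      (hasFDerivAt_prodMk_right s x)
  have h2 : HasMFDerivAt 𝓘(ℝ, E) 𝓘(ℝ, E) (extChartAt 𝓘(ℝ, E) p).symm x
      (mfderiv 𝓘(ℝ, E) 𝓘(ℝ, E) (extChartAt 𝓘(ℝ, E) p).symm x) :=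
    ((contMDiffAt_extChartAt_symm hx).mdifferentiableAt (by simp)).hasMFDerivAt
  have h3 : HasMFDerivAt 𝓘(ℝ, E) 𝓘(ℝ, E) (fun q : M => a • q) q
      (mfderiv 𝓘(ℝ, E) 𝓘(ℝ, E) (fun q : M => a • q) q) :=
    ((contMDiff_smul_left hact a).mdifferentiableAt (by simp)).hasMFDerivAt
  have h4 : HasMFDerivAt 𝓘(ℝ, E) 𝓘(ℝ, E) (extChartAt 𝓘(ℝ, E) p) (a • q)
      (mfderiv 𝓘(ℝ, E) 𝓘(ℝ, E) (extChartAt 𝓘(ℝ, E) p) (a • q)) :=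
    (mdifferentiableAt_extChartAt hsx).hasMFDerivAt
  have h5 := (h4.comp x (h3.comp x h2)).hasFDerivAt
  have h6 := congrArg (fun L : E →L[ℝ] E => L v) (h1.unique h5)
  have e1 := TangentBundle.continuousLinearMapAt_trivializationAt (I := 𝓘(ℝ, E)) hsx
  have e2 := TangentBundle.symmL_trivializationAt (I := 𝓘(ℝ, E)) hq
  rw [chartFrame, e1, e2, (extChartAt 𝓘(ℝ, E) p).right_inv hx, ModelWithCorners.range_eq_univ,
    mfderivWithin_univ]
  refine Eq.trans ?_ (h6.trans rfl)
  simp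

/-- Identifies the infinitesimal generator of the action in charts, the field `Y` of
`killing_equation_of_isometric_family`. -/
theorem fderiv_chartAction_left
    (hact : ContMDiff (𝓘(ℝ, F).prod 𝓘(ℝ, E)) 𝓘(ℝ, E) ∞ (fun q : G × M => q.1 • q.2))
    {p : M} {x : E} (hx : x ∈ (extChartAt 𝓘(ℝ, E) p).target) (X : GroupLieAlgebra 𝓘(ℝ, F) G) :
    fderiv ℝ (chartAction F G p) (extChartAt 𝓘(ℝ, F) (1 : G) 1, x) (X, 0)
      = chartField p (fundamentalField 𝓘(ℝ, E) X) x := by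
  obtain ⟨s, hs_def⟩ : ∃ s : F, s = extChartAt 𝓘(ℝ, F) (1 : G) 1 := ⟨_, rfl⟩
  rw [← hs_def]
  set q := (extChartAt 𝓘(ℝ, E) p).symm x with hqdef
  have hs : s ∈ (extChartAt 𝓘(ℝ, F) (1 : G)).target := by
    rw [hs_def]; exact mem_extChartAt_target 1
  have hs1 : (extChartAt 𝓘(ℝ, F) (1 : G)).symm s = 1 := by
    rw [hs_def]; exact extChartAt_to_inv 1
  have hq : q ∈ (chartAt E p).source := extChartAt_symm_mem_source hx
  have hsx : (extChartAt 𝓘(ℝ, F) (1 : G)).symm s • q ∈ (chartAt E p).source := by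
    rwa [hs1, one_smul]
  have h1 : HasFDerivAt (fun t => chartAction F G p (t, x))
      ((fderiv ℝ (chartAction F G p) (s, x)).comp (ContinuousLinearMap.inl ℝ F E)) s := by
    have hd := ((contDiffAt_chartAction hact hs hx hsx).differentiableAt (by simp)).hasFDerivAt
    exact HasFDerivAt.comp (f := fun e : F => (e, x)) s hd (hasFDerivAt_prodMk_left s x)
  -- The preferred chart at `1` has identity differential there, so `X` is its own coordinate
  -- vector.
  have h2 : HasMFDerivAt 𝓘(ℝ, F) 𝓘(ℝ, F) (extChartAt 𝓘(ℝ, F) (1 : G)).symm s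
      (ContinuousLinearMap.id ℝ F) := by
    have h := ((contMDiffAt_extChartAt_symm hs).mdifferentiableAt
      (n := ∞) (by simp)).hasMFDerivAt
    have h' := mfderivWithin_range_extChartAt_symm (I := 𝓘(ℝ, F)) (x := (1 : G))
    rw [ModelWithCorners.range_eq_univ, mfderivWithin_univ] at h'
    rw [hs_def] at h ⊢
    rwa [h'] at h
  have h3 : HasMFDerivAt 𝓘(ℝ, F) 𝓘(ℝ, E) (fun a : G => a • q)
      ((extChartAt 𝓘(ℝ, F) (1 : G)).symm s)
      (mfderiv 𝓘(ℝ, F) 𝓘(ℝ, E) (fun a : G => a • q) ((extChartAt 𝓘(ℝ, F) (1 : G)).symm s)) :=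
    ((contMDiff_smul_right hact q).mdifferentiableAt (by simp)).hasMFDerivAt
  have h4 : HasMFDerivAt 𝓘(ℝ, E) 𝓘(ℝ, E) (extChartAt 𝓘(ℝ, E) p)
      ((extChartAt 𝓘(ℝ, F) (1 : G)).symm s • q)
      (mfderiv 𝓘(ℝ, E) 𝓘(ℝ, E) (extChartAt 𝓘(ℝ, E) p)
        ((extChartAt 𝓘(ℝ, F) (1 : G)).symm s • q)) :=
    (mdifferentiableAt_extChartAt hsx).hasMFDerivAt
  have h5 := (h4.comp s (h3.comp s h2)).hasFDerivAt
  have h6 := congrArg (fun L : F →L[ℝ] E => L X) (h1.unique h5)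
  have e1 := TangentBundle.continuousLinearMapAt_trivializationAt (I := 𝓘(ℝ, E)) hq
  rw [chartField, ← hqdef, e1, fundamentalField]
  have h7 : fderiv ℝ (chartAction F G p) (s, x) (X, 0) =
    (mfderiv 𝓘(ℝ, E) 𝓘(ℝ, E) (extChartAt 𝓘(ℝ, E) p)
        ((extChartAt 𝓘(ℝ, F) (1 : G)).symm s • q) : E →L[ℝ] E)
      ((mfderiv 𝓘(ℝ, F) 𝓘(ℝ, E) (fun a : G => a • q) ((extChartAt 𝓘(ℝ, F) (1 : G)).symm s)
        : F →L[ℝ] E) X) := by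
    refine Eq.trans ?_ (h6.trans rfl)
    rfl
  rw [hs1, one_smul] at h7
  exact h7

variable [FiniteDimensional ℝ E] [RiemannianBundle (fun x : M => TangentSpace 𝓘(ℝ, E) x)]
  [IsContMDiffRiemannianBundle 𝓘(ℝ, E) ∞ E (fun x : M => TangentSpace 𝓘(ℝ, E) x)]

/-- Fundamental vector fields of an isometric action are Killing fields. -/
theorem killing_equation_chartField (hM : IsHomogeneousRiemannian 𝓘(ℝ, F) 𝓘(ℝ, E) G M) (p : M)
    (X : GroupLieAlgebra 𝓘(ℝ, F) G) {x : E} (hx : x ∈ (extChartAt 𝓘(ℝ, E) p).target) (v w : E) :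
    fderiv ℝ (chartMetric p) x (chartField p (fundamentalField 𝓘(ℝ, E) X) x) v w
      + chartMetric p x (fderiv ℝ (chartField p (fundamentalField 𝓘(ℝ, E) X)) x v) w
      + chartMetric p x v (fderiv ℝ (chartField p (fundamentalField 𝓘(ℝ, E) X)) x w) = 0 := by
  obtain ⟨s₀, hs₀⟩ : ∃ s : F, s = extChartAt 𝓘(ℝ, F) (1 : G) 1 := ⟨_, rfl⟩
  have hs : s₀ ∈ (extChartAt 𝓘(ℝ, F) (1 : G)).target := by
    rw [hs₀]; exact mem_extChartAt_target 1
  have hs1 : (extChartAt 𝓘(ℝ, F) (1 : G)).symm s₀ = 1 := by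
    rw [hs₀]; exact extChartAt_to_inv 1
  set q := (extChartAt 𝓘(ℝ, E) p).symm x with hq_def
  have hq : q ∈ (chartAt E p).source := extChartAt_symm_mem_source hx
  have htarget := (isOpen_extChartAt_target (I := 𝓘(ℝ, E)) p).mem_nhds hx
  have hsx : (extChartAt 𝓘(ℝ, F) (1 : G)).symm s₀ • q ∈ (chartAt E p).source := by
    rwa [hs1, one_smul]
  refine killing_equation_of_isometric_family (F := F) (s₀ := s₀) (X := X) (Φ := chartAction F G p)
    ((contDiffAt_chartAction hM.contMDiff hs hx hsx).of_le two_le_infty) ?_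
    (((contDiffOn_chartMetric p).contDiffAt htarget).differentiableAt (by simp)) ?_ ?_ v w
  · filter_upwards [htarget] with y hy
    rw [chartAction, hs1, one_smul, (extChartAt 𝓘(ℝ, E) p).right_inv hy]
  · filter_upwards [htarget] with y hy
    rw [hs₀]
    exact (fderiv_chartAction_left hM.contMDiff hy X).symm
  · have hcont : ContinuousAt (fun s => (extChartAt 𝓘(ℝ, F) (1 : G)).symm s • q) s₀ :=
      ((contMDiff_smul_right hM.contMDiff q).continuous.continuousAt).comp
        (contMDiffAt_extChartAt_symm hs).continuousAt
    filter_upwards [(isOpen_extChartAt_target (I := 𝓘(ℝ, F)) (1 : G)).mem_nhds hs,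
      hcont.preimage_mem_nhds ((chartAt E p).open_source.mem_nhds hsx)] with s hs' hsx' v w
    rw [fderiv_chartAction_right hM.contMDiff hs' hx hsx',
      fderiv_chartAction_right hM.contMDiff hs' hx hsx', chartMetric, chartAction,
      (extChartAt 𝓘(ℝ, E) p).left_inv (by rw [extChartAt_source]; exact hsx'),
      frameMetric_continuousLinearMapAt hsx', hM.isometric]
    rfl

/-- A Killing field that vanishes to first order at a point, read in a chart there, vanishes near
that point. -/
theorem eventually_fundamentalField_eq_zero (hM : IsHomogeneousRiemannian 𝓘(ℝ, F) 𝓘(ℝ, E) G M)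
    (p : M) (X : GroupLieAlgebra 𝓘(ℝ, F) G)
    (h₀ : chartField p (fundamentalField 𝓘(ℝ, E) X) (extChartAt 𝓘(ℝ, E) p p) = 0)
    (h₁ : fderiv ℝ (chartField p (fundamentalField 𝓘(ℝ, E) X)) (extChartAt 𝓘(ℝ, E) p p) = 0) :
    ∀ᶠ q in 𝓝 p, fundamentalField 𝓘(ℝ, E) X q = 0 := by
  have htarget := (isOpen_extChartAt_target (I := 𝓘(ℝ, E)) p).mem_nhds (mem_extChartAt_target p)
  obtain ⟨c, hc, hpos⟩ := exists_le_chartMetric (E := E) p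
  have hzero := eventually_eq_zero_of_killing_equation
    (g := chartMetric p) (((contDiffOn_chartMetric p).contDiffAt htarget).of_le two_le_infty)
    (((contDiffOn_chartField p (contMDiff_fundamentalField hM.contMDiff X)).contDiffAt
      htarget).of_le two_le_infty)
    (Eventually.of_forall (chartMetric_symm p)) hc hpos
    (mem_of_superset htarget fun x hx v w => killing_equation_chartField hM p X hx v w) h₀ h₁
  filter_upwards [(continuousAt_extChartAt (I := 𝓘(ℝ, E)) p).eventually hzero,
    (chartAt E p).open_source.mem_nhds (mem_chart_source E p)] with q hq hmem
  rw [chartField, (extChartAt 𝓘(ℝ, E) p).left_inv (by rwa [extChartAt_source])] at hq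
  rw [← Trivialization.symmL_continuousLinearMapAt (R := ℝ)
    (trivializationAt E (TangentSpace 𝓘(ℝ, E)) p) hmem (fundamentalField 𝓘(ℝ, E) X q), hq, map_zero]

/-- On a connected manifold, a Killing field that vanishes to first order at a point is zero. -/
theorem fundamentalField_eq_zero [ConnectedSpace M]
    (hM : IsHomogeneousRiemannian 𝓘(ℝ, F) 𝓘(ℝ, E) G M) (o : M) (X : GroupLieAlgebra 𝓘(ℝ, F) G)
    (h₀ : chartField o (fundamentalField 𝓘(ℝ, E) X) (extChartAt 𝓘(ℝ, E) o o) = 0)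
    (h₁ : fderiv ℝ (chartField o (fundamentalField 𝓘(ℝ, E) X)) (extChartAt 𝓘(ℝ, E) o o) = 0)
    (q : M) : fundamentalField 𝓘(ℝ, E) X q = 0 := by
  -- Local vanishing is an open condition. At a limit point of `S` the 1-jet vanishes by continuity,
  -- so local rigidity makes `S` closed.
  set S := {p : M | ∀ᶠ q in 𝓝 p, fundamentalField 𝓘(ℝ, E) X q = 0}
  have hopen : IsOpen S := isOpen_iff_mem_nhds.2 fun p hp => eventually_eventually_nhds.2 hp
  have hclosed : IsClosed S := by
    refine isClosed_of_closure_subset fun p hp => ?_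
    set φ := extChartAt 𝓘(ℝ, E) p
    set Y := chartField p (fundamentalField 𝓘(ℝ, E) X)
    have htarget := (isOpen_extChartAt_target (I := 𝓘(ℝ, E)) p).mem_nhds (mem_extChartAt_target p)
    have hY : ContDiffAt ℝ ∞ Y (φ p) :=
      (contDiffOn_chartField p (contMDiff_fundamentalField hM.contMDiff X)).contDiffAt htarget
    have hcont : ContinuousAt (fun q => (Y (φ q), fderiv ℝ Y (φ q))) p :=
      ContinuousAt.comp (f := φ) (hY.continuousAt.prodMk
        (hY.fderiv_right (m := 0) (by simp)).continuousAt) (continuousAt_extChartAt p)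
    have hfreq : ∃ᶠ q in 𝓝 p, (Y (φ q), fderiv ℝ Y (φ q)) = 0 := by
      refine ((mem_closure_iff_frequently.1 hp).and_eventually
        ((chartAt E p).open_source.mem_nhds (mem_chart_source E p))).mono fun q hq => ?_
      have hq' : q ∈ φ.source := by rw [extChartAt_source]; exact hq.2
      have hev : ∀ᶠ x in 𝓝 (φ q), Y x = 0 := by
        have hc : Tendsto φ.symm (𝓝 (φ q)) (𝓝 q) := by
          have := continuousAt_extChartAt_symm' hq'
          rwa [ContinuousAt, φ.left_inv hq'] at this
        filter_upwards [hc.eventually hq.1] with x hx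
        simp only [Y, chartField]
        rw [hx, map_zero]
      rw [Prod.mk_eq_zero]
      refine ⟨hev.self_of_nhds, ?_⟩
      rw [EventuallyEq.fderiv_eq (f := fun _ => (0 : E)) hev]
      simp
    have hval : (Y (φ p), fderiv ℝ Y (φ p)) = 0 := by
      by_contra hne
      exact hfreq (hcont.eventually_ne hne)
    rw [Prod.mk_eq_zero] at hval
    exact eventually_fundamentalField_eq_zero hM p X hval.1 hval.2
  have hS : S = Set.univ := IsClopen.eq_univ ⟨hclosed, hopen⟩
    ⟨o, eventually_fundamentalField_eq_zero hM o X h₀ h₁⟩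
  have hq : q ∈ S := hS ▸ Set.mem_univ q
  exact hq.self_of_nhds

end FundamentalFields

/-! ### Effective actions have no zero fundamental fields -/

section Effective

open Filter Topology

variable {F : Type*} [NormedAddCommGroup F] [NormedSpace ℝ F] [CompleteSpace F]
  {E : Type*} [NormedAddCommGroup E] [NormedSpace ℝ E]
  {G : Type*} [TopologicalSpace G] [ChartedSpace F G] [Group G] [LieGroup 𝓘(ℝ, F) ∞ G]
  {M : Type*} [TopologicalSpace M] [ChartedSpace E M] [MulAction G M] [IsManifold 𝓘(ℝ, E) ∞ M]

theorem mulInvariantVectorField_one (X : GroupLieAlgebra 𝓘(ℝ, F) G) :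
    mulInvariantVectorField X (1 : G) = X := by
  have h : HasMFDerivAt 𝓘(ℝ, F) 𝓘(ℝ, F) (fun a : G => 1 * a) 1
      (ContinuousLinearMap.id ℝ (TangentSpace 𝓘(ℝ, F) (1 : G))) := by
    have := hasMFDerivAt_id (I := 𝓘(ℝ, F)) (1 : G)
    exact this.congr_of_eventuallyEq (Eventually.of_forall fun a => one_mul a)
  unfold mulInvariantVectorField
  rw [h.mfderiv]
  rfl

/-- Differentiate `(a * b) • p = a • (b • p)` in `b` at `1`. -/
theorem mfderiv_smul_right_mulInvariantVectorField
    (hact : ContMDiff (𝓘(ℝ, F).prod 𝓘(ℝ, E)) 𝓘(ℝ, E) ∞ (fun q : G × M => q.1 • q.2))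
    (X : GroupLieAlgebra 𝓘(ℝ, F) G) (a : G) (p : M) :
    (mfderiv 𝓘(ℝ, F) 𝓘(ℝ, E) (fun b : G => b • p) a (mulInvariantVectorField X a) : E)
      = mfderiv 𝓘(ℝ, E) 𝓘(ℝ, E) (fun q : M => a • q) p (fundamentalField 𝓘(ℝ, E) X p) := by
  have h1 : HasMFDerivAt 𝓘(ℝ, F) 𝓘(ℝ, F) (fun b : G => a * b) 1
      (mfderiv 𝓘(ℝ, F) 𝓘(ℝ, F) (fun b : G => a * b) 1) :=
    (contMDiff_mul_left.mdifferentiableAt (n := ∞) (by simp)).hasMFDerivAt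
  have h2 : HasMFDerivAt 𝓘(ℝ, F) 𝓘(ℝ, E) (fun b : G => b • p) (a * 1)
      (mfderiv 𝓘(ℝ, F) 𝓘(ℝ, E) (fun b : G => b • p) (a * 1)) :=
    ((contMDiff_smul_right hact p).mdifferentiableAt (by simp)).hasMFDerivAt
  have h3 : HasMFDerivAt 𝓘(ℝ, F) 𝓘(ℝ, E) (fun b : G => b • p) 1
      (mfderiv 𝓘(ℝ, F) 𝓘(ℝ, E) (fun b : G => b • p) 1) :=
    ((contMDiff_smul_right hact p).mdifferentiableAt (by simp)).hasMFDerivAt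
  have h4 : HasMFDerivAt 𝓘(ℝ, E) 𝓘(ℝ, E) (fun q : M => a • q) ((1 : G) • p)
      (mfderiv 𝓘(ℝ, E) 𝓘(ℝ, E) (fun q : M => a • q) ((1 : G) • p)) :=
    ((contMDiff_smul_left hact a).mdifferentiableAt (by simp)).hasMFDerivAt
  have h5 := (h2.comp 1 h1).mfderiv.symm.trans (((h4.comp 1 h3).congr_of_eventuallyEq
    (Eventually.of_forall fun b => by simp [mul_smul])).mfderiv)
  have h6 : (mfderiv 𝓘(ℝ, F) 𝓘(ℝ, E) (fun b : G => b • p) (a * 1) : F →L[ℝ] E)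
      (mulInvariantVectorField X a : F)
      = (mfderiv 𝓘(ℝ, E) 𝓘(ℝ, E) (fun q : M => a • q) ((1 : G) • p) : E →L[ℝ] E)
        (fundamentalField 𝓘(ℝ, E) X p : E) := congrArg (fun L : F →L[ℝ] E => L X) h5
  rw [mul_one, one_smul] at h6
  exact h6

/-- For an effective action, only the zero element generates the zero fundamental field. -/
theorem eq_zero_of_fundamentalField_eq_zero [T2Space M] [FaithfulSMul G M]
    (hact : ContMDiff (𝓘(ℝ, F).prod 𝓘(ℝ, E)) 𝓘(ℝ, E) ∞ (fun q : G × M => q.1 • q.2))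
    {X : GroupLieAlgebra 𝓘(ℝ, F) G} (hX : ∀ p : M, fundamentalField 𝓘(ℝ, E) X p = 0) :
    X = 0 := by
  have : LieGroup 𝓘(ℝ, F) (minSmoothness ℝ 3) G :=
    LieGroup.of_le (n := ∞) (by simpa using ENat.LEInfty.out)
  -- A local integral curve of the left-invariant field through `1` plays the role of `exp (t X)`.
  obtain ⟨γ, h0, hγ⟩ := exists_isMIntegralCurveAt_of_contMDiffAt_boundaryless (t₀ := 0)
    ((contMDiffAt_mulInvariantVectorField X (g := (1 : G))).of_le (by simp))
  obtain ⟨ε, hε, hball⟩ := isMIntegralCurveAt_iff'.1 hγ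
  rw [Real.ball_eq_Ioo, zero_sub, zero_add] at hball
  have hmem : (0 : ℝ) ∈ Set.Ioo (-ε) ε := ⟨neg_lt_zero.2 hε, hε⟩
  have hfix : ∀ t ∈ Set.Ioo (-ε) ε, γ t = 1 := by
    intro t ht
    refine eq_of_smul_eq_smul (α := M) fun p => ?_
    -- Each `γ t • p` is an integral curve of the zero field, hence constant by uniqueness;
    -- faithfulness then forces `γ t = 1`.
    have hcurve : IsMIntegralCurveOn (I := 𝓘(ℝ, E)) (fun t => γ t • p)
        (fun q => (0 : TangentSpace 𝓘(ℝ, E) q)) (Set.Ioo (-ε) ε) := by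
      intro t ht
      have h2 : HasMFDerivAt 𝓘(ℝ, F) 𝓘(ℝ, E) (fun b : G => b • p) (γ t)
          (mfderiv 𝓘(ℝ, F) 𝓘(ℝ, E) (fun b : G => b • p) (γ t)) :=
        ((contMDiff_smul_right hact p).mdifferentiableAt (by simp)).hasMFDerivAt
      have h3 := h2.comp_hasMFDerivWithinAt t (hball t ht)
      refine h3.congr_mfderiv (ContinuousLinearMap.ext (M₁ := ℝ) (M₂ := E) fun r => ?_)
      have h4 := mfderiv_smul_right_mulInvariantVectorField hact X (γ t) p
      rw [hX, map_zero] at h4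
      change (mfderiv 𝓘(ℝ, F) 𝓘(ℝ, E) (fun b : G => b • p) (γ t) : F →L[ℝ] E)
        (r • (mulInvariantVectorField X (γ t) : F)) = r • (0 : E)
      rw [map_smul]
      exact congrArg (r • ·) h4
    have hconst : IsMIntegralCurveOn (I := 𝓘(ℝ, E)) (fun _ => p)
        (fun q => (0 : TangentSpace 𝓘(ℝ, E) q)) (Set.Ioo (-ε) ε) :=
      (isMIntegralCurve_const rfl).isMIntegralCurveOn _
    have h := isMIntegralCurveOn_Ioo_eqOn_of_contMDiff_boundaryless hmem
      (contMDiff_zeroSection ℝ (TangentSpace 𝓘(ℝ, E) : M → Type _)) hcurve hconst (by simp [h0]) ht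
    simpa using h
  have hder := hγ.hasMFDerivAt
  have hone : HasMFDerivAt 𝓘(ℝ, ℝ) 𝓘(ℝ, F) γ 0 0 :=
    (hasMFDerivAt_const (1 : G) (0 : ℝ)).congr_of_eventuallyEq
      (mem_of_superset (Ioo_mem_nhds hmem.1 hmem.2) hfix)
  -- The velocity of `γ` at `0` is both `X` and `0`.
  have h := congrArg (fun L : ℝ →L[ℝ] F => L 1) (hasMFDerivAt_unique hder hone)
  have h' : (1 : ℝ) • (mulInvariantVectorField X (γ 0) : F) = 0 := h
  rw [one_smul, h0] at h'
  rw [← mulInvariantVectorField_one X]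
  exact h'

end Effective

/-! ### Lie brackets in a chart -/

section ChartBracket

open Filter Topology

variable {E : Type*} [NormedAddCommGroup E] [NormedSpace ℝ E] [FiniteDimensional ℝ E]
  {M : Type*} [TopologicalSpace M] [ChartedSpace E M] [IsManifold 𝓘(ℝ, E) ∞ M]

theorem chartFrame_self (p : M) (v : E) : (chartFrame p v p : E) = v := by
  have h := TangentBundle.symmL_trivializationAt (I := 𝓘(ℝ, E)) (mem_chart_source E p)
  rw [mfderivWithin_range_extChartAt_symm] at h
  exact congrArg (fun L : E →L[ℝ] E => L v) h

theorem chartField_self (p : M) (Y : Π q : M, TangentSpace 𝓘(ℝ, E) q) :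
    chartField p Y (extChartAt 𝓘(ℝ, E) p p) = Y p := by
  have h := TangentBundle.continuousLinearMapAt_trivializationAt (I := 𝓘(ℝ, E))
    (mem_chart_source E p)
  rw [mfderiv_extChartAt_self] at h
  rw [chartField, extChartAt_to_inv, h]
  rfl

/-- The manifold bracket is computed from these pullbacks; matching them with `chartField` reduces
brackets to ordinary derivatives. -/
theorem mpullbackWithin_extChartAt_symm {p : M} (Y : Π q : M, TangentSpace 𝓘(ℝ, E) q) {x : E}
    (hx : x ∈ (extChartAt 𝓘(ℝ, E) p).target) :
    mpullbackWithin 𝓘(ℝ, E) 𝓘(ℝ, E) (extChartAt 𝓘(ℝ, E) p).symm Y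
      (Set.range (𝓘(ℝ, E) : ModelWithCorners ℝ E E)) x = chartField p Y x := by
  have h := TangentBundle.continuousLinearMapAt_trivializationAt (I := 𝓘(ℝ, E))
    (extChartAt_symm_mem_source hx)
  rw [mpullbackWithin_apply, chartField, h, ContinuousLinearMap.inverse_eq
    (mfderivWithin_extChartAt_symm_comp_mfderiv_extChartAt hx)
    (mfderiv_extChartAt_comp_mfderivWithin_extChartAt_symm hx)]
  rfl

theorem chartField_chartFrame {p : M} (v : E) {x : E} (hx : x ∈ (extChartAt 𝓘(ℝ, E) p).target) :
    chartField p (chartFrame p v) x = v :=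
  Trivialization.continuousLinearMapAt_symmL _ (extChartAt_symm_mem_source hx) v

theorem lieBracketWithin_eq_fderiv_of_eventuallyEq_const {V W Y : E → E} {S : Set E} {x v : E}
    (hS : S = Set.univ) (hV : V =ᶠ[𝓝 x] fun _ => v) (hW : W =ᶠ[𝓝 x] Y) :
    lieBracketWithin ℝ V W S x = fderiv ℝ Y x v := by
  rw [hS, lieBracketWithin_univ, hV.lieBracket_vectorField_eq hW, lieBracket_eq]
  simp

/-- The Lie bracket with a vector field that is constant in the chart. -/
theorem mlieBracket_chartFrame_left (p : M) (v : E) (Y : Π q : M, TangentSpace 𝓘(ℝ, E) q) :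
    (mlieBracket 𝓘(ℝ, E) (chartFrame p v) Y p : E)
      = fderiv ℝ (chartField p Y) (extChartAt 𝓘(ℝ, E) p p) v := by
  have htarget := (isOpen_extChartAt_target (I := 𝓘(ℝ, E)) p).mem_nhds (mem_extChartAt_target p)
  have hV : mpullbackWithin 𝓘(ℝ, E) 𝓘(ℝ, E) (extChartAt 𝓘(ℝ, E) p).symm (chartFrame p v)
      (Set.range (𝓘(ℝ, E) : ModelWithCorners ℝ E E)) =ᶠ[𝓝 (extChartAt 𝓘(ℝ, E) p p)]
      fun _ => v := by
    filter_upwards [htarget] with x hx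
    rw [mpullbackWithin_extChartAt_symm _ hx, chartField_chartFrame v hx]
  have hY : mpullbackWithin 𝓘(ℝ, E) 𝓘(ℝ, E) (extChartAt 𝓘(ℝ, E) p).symm Y
      (Set.range (𝓘(ℝ, E) : ModelWithCorners ℝ E E)) =ᶠ[𝓝 (extChartAt 𝓘(ℝ, E) p p)]
      chartField p Y := by
    filter_upwards [htarget] with x hx
    rw [mpullbackWithin_extChartAt_symm _ hx]
  have hS : (extChartAt 𝓘(ℝ, E) p).symm ⁻¹' Set.univ
      ∩ Set.range (𝓘(ℝ, E) : ModelWithCorners ℝ E E) = Set.univ := by simp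
  have hb := lieBracketWithin_eq_fderiv_of_eventuallyEq_const (E := E) hS hV hY
  have hinv : (mfderiv 𝓘(ℝ, E) 𝓘(ℝ, E) (extChartAt 𝓘(ℝ, E) p) p).inverse
      = ContinuousLinearMap.id ℝ E := by
    rw [mfderiv_extChartAt_self]
    exact ContinuousLinearMap.inverse_id
  rw [← hb]
  exact congrArg (fun L : E →L[ℝ] E => L _) hinv

end ChartBracket

/-! ### Skewness and linearity of the Kostant operator -/

section KostantOperator

open Filter Topology

variable {F : Type*} [NormedAddCommGroup F] [NormedSpace ℝ F]
  {E : Type*} [NormedAddCommGroup E] [NormedSpace ℝ E] [FiniteDimensional ℝ E] [CompleteSpace E]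
  {G : Type*} [TopologicalSpace G] [ChartedSpace F G] [Group G] [IsManifold 𝓘(ℝ, F) ∞ G]
  {M : Type*} [TopologicalSpace M] [ChartedSpace E M] [MulAction G M] [IsManifold 𝓘(ℝ, E) ∞ M]
  [RiemannianBundle (fun x : M => TangentSpace 𝓘(ℝ, E) x)]
  [IsContMDiffRiemannianBundle 𝓘(ℝ, E) ∞ E (fun x : M => TangentSpace 𝓘(ℝ, E) x)]

theorem chartMetric_self (p : M) (v w : E) :
    chartMetric p (extChartAt 𝓘(ℝ, E) p p) v w
      = inner ℝ (chartFrame p v p) (chartFrame p w p) := by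
  rw [chartMetric, extChartAt_to_inv, frameMetric_apply]

theorem mvfderiv_inner_chartFrame (p : M) (v w : E) (u : TangentSpace 𝓘(ℝ, E) p) :
    mvfderiv 𝓘(ℝ, E) (fun q => inner ℝ (chartFrame p v q) (chartFrame p w q)) p u
      = fderiv ℝ (chartMetric p) (extChartAt 𝓘(ℝ, E) p p) u v w := by
  have htarget := (isOpen_extChartAt_target (I := 𝓘(ℝ, E)) p).mem_nhds (mem_extChartAt_target p)
  have h1 : HasFDerivAt (chartMetric p)
      (fderiv ℝ (chartMetric p) (extChartAt 𝓘(ℝ, E) p p)) (extChartAt 𝓘(ℝ, E) p p) :=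
    (((contDiffOn_chartMetric p).contDiffAt htarget).differentiableAt (by simp)).hasFDerivAt
  have h2 := ((h1.clm_apply (hasFDerivAt_const v _)).clm_apply (hasFDerivAt_const w _)).hasMFDerivAt
  have h3 := (mdifferentiableAt_extChartAt (I := 𝓘(ℝ, E)) (mem_chart_source E p)).hasMFDerivAt
  rw [mfderiv_extChartAt_self] at h3
  have h4 := (h2.comp p h3).congr_of_eventuallyEq
    (f₁ := fun q => inner ℝ (chartFrame p v q) (chartFrame p w q)) (by
      filter_upwards [extChartAt_source_mem_nhds (I := 𝓘(ℝ, E)) p] with q hq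
      rw [Function.comp_apply, chartMetric, (extChartAt 𝓘(ℝ, E) p).left_inv hq, frameMetric_apply])
  have h5 := congrArg (fun L : E →L[ℝ] ℝ => L u) h4.mfderiv
  refine Eq.trans (b := (mfderiv 𝓘(ℝ, E) 𝓘(ℝ, ℝ)
    (fun q => inner ℝ (chartFrame p v q) (chartFrame p w q)) p : E →L[ℝ] ℝ) u) rfl (h5.trans ?_)
  simp
  rfl

theorem mdifferentiableAt_fundamentalField (hM : IsHomogeneousRiemannian 𝓘(ℝ, F) 𝓘(ℝ, E) G M)
    (X : GroupLieAlgebra 𝓘(ℝ, F) G) (p : M) :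
    MDiffAt (T% (fundamentalField 𝓘(ℝ, E) X : Π p : M, TangentSpace 𝓘(ℝ, E) p)) p :=
  (contMDiff_fundamentalField hM.contMDiff X).mdifferentiableAt (by simp)

/-- The covariant derivative of a Killing field is skew-symmetric. -/
theorem inner_leviCivitaFun_fundamentalField_self
    (hM : IsHomogeneousRiemannian 𝓘(ℝ, F) 𝓘(ℝ, E) G M) (X : GroupLieAlgebra 𝓘(ℝ, F) G) (o : M)
    (v : TangentSpace 𝓘(ℝ, E) o) :
    inner ℝ (leviCivitaFun (fundamentalField 𝓘(ℝ, E) X) o v) v = 0 := by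
  set Y : Π p : M, TangentSpace 𝓘(ℝ, E) p := fundamentalField 𝓘(ℝ, E) X
  obtain ⟨u, rfl⟩ : ∃ u : E, chartFrame o u o = v := ⟨v, chartFrame_self (E := E) o v⟩
  have hV := mdifferentiableAt_chartFrame o u
  rw [inner_leviCivitaFun (mdifferentiableAt_fundamentalField hM X o) hV hV, koszul]
  have hsymm : (fun x => inner ℝ (Y x) (chartFrame o u x))
      = fun x => inner ℝ (chartFrame o u x) (Y x) := funext fun x => real_inner_comm _ _
  have hbracket : inner ℝ (mlieBracket 𝓘(ℝ, E) (chartFrame o u) Y o) (chartFrame o u o)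
      = chartMetric o (extChartAt 𝓘(ℝ, E) o o)
        (fderiv ℝ (chartField o Y) (extChartAt 𝓘(ℝ, E) o o) u) u := by
    rw [chartMetric_self]
    congr 1
    exact (mlieBracket_chartFrame_left o u Y).trans (chartFrame_self o _).symm
  have hK := killing_equation_chartField hM o X (mem_extChartAt_target o) u u
  rw [chartMetric_symm o _ u, chartField_self] at hK
  have hd := mvfderiv_inner_chartFrame o u u (Y o)
  -- With `V = W = U` the chart-constant field, Koszul's formula collapses to `½ Y⟨U, U⟩ + ⟨[U, Y],
  -- U⟩`, which is half of Killing's equation on the diagonal.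
  rw [hsymm, mlieBracket_self, mlieBracket_swap_apply (V := Y), inner_neg_left, hbracket, hd]
  simp only [Pi.zero_apply, inner_zero_left]
  linarith

attribute [local instance 100] LieRing.ofAssociativeRing in
theorem kostantOperator_mem_soLie (hM : IsHomogeneousRiemannian 𝓘(ℝ, F) 𝓘(ℝ, E) G M) (o : M)
    (X : GroupLieAlgebra 𝓘(ℝ, F) G) :
    kostantOperator 𝓘(ℝ, E) o X ∈ soLie (TangentSpace 𝓘(ℝ, E) o) := by
  rw [mem_soLie_iff]
  intro v w
  have h : ∀ u : TangentSpace 𝓘(ℝ, E) o,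
      inner ℝ (kostantOperator 𝓘(ℝ, E) o X u) u = 0 :=
    inner_leviCivitaFun_fundamentalField_self hM X o
  -- Polarisation of the vanishing quadratic form.
  have h1 := h (v + w)
  rw [map_add, inner_add_left, inner_add_right, inner_add_right, h v, h w,
    real_inner_comm] at h1
  rw [real_inner_comm w, real_inner_comm v] at *
  linarith

theorem kostantOperator_add (hM : IsHomogeneousRiemannian 𝓘(ℝ, F) 𝓘(ℝ, E) G M)
    (o : M) (X Y : GroupLieAlgebra 𝓘(ℝ, F) G) :
    kostantOperator 𝓘(ℝ, E) o (X + Y)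
      = kostantOperator 𝓘(ℝ, E) o X + kostantOperator 𝓘(ℝ, E) o Y := by
  have h := (leviCivita (I := 𝓘(ℝ, E)) (M := M)).isCovariantDerivativeOnUniv.add
    (mdifferentiableAt_fundamentalField hM X o) (mdifferentiableAt_fundamentalField hM Y o)
    (Set.mem_univ o)
  rw [← fundamentalField_add] at h
  ext v
  exact congrArg (fun L : TangentSpace 𝓘(ℝ, E) o →L[ℝ] TangentSpace 𝓘(ℝ, E) o => L v) h

theorem kostantOperator_smul (hM : IsHomogeneousRiemannian 𝓘(ℝ, F) 𝓘(ℝ, E) G M)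
    (o : M) (c : ℝ) (X : GroupLieAlgebra 𝓘(ℝ, F) G) :
    kostantOperator 𝓘(ℝ, E) o (c • X) = c • kostantOperator 𝓘(ℝ, E) o X := by
  have h := (leviCivita (I := 𝓘(ℝ, E)) (M := M)).isCovariantDerivativeOnUniv.smul_const
    c (mdifferentiableAt_fundamentalField hM X o) (Set.mem_univ o)
  rw [← fundamentalField_smul] at h
  ext v
  exact congrArg (fun L : TangentSpace 𝓘(ℝ, E) o →L[ℝ] TangentSpace 𝓘(ℝ, E) o => L v) h

end KostantOperator

/-! ### Injectivity on the isotropy algebra and positivity -/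

section KostantMap

variable {F : Type*} [NormedAddCommGroup F] [NormedSpace ℝ F]
  {E : Type*} [NormedAddCommGroup E] [NormedSpace ℝ E] [FiniteDimensional ℝ E] [CompleteSpace E]
  {G : Type*} [TopologicalSpace G] [ChartedSpace F G] [Group G] [LieGroup 𝓘(ℝ, F) ∞ G]
  {M : Type*} [TopologicalSpace M] [ChartedSpace E M] [MulAction G M] [IsManifold 𝓘(ℝ, E) ∞ M]
  [RiemannianBundle (fun x : M => TangentSpace 𝓘(ℝ, E) x)]
  [IsContMDiffRiemannianBundle 𝓘(ℝ, E) ∞ E (fun x : M => TangentSpace 𝓘(ℝ, E) x)]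

attribute [local instance 100] LieRing.ofAssociativeRing

/-- The Kostant operators as a linear map to `𝔰𝔬(T_o M)`. -/
def kostantMap (hM : IsHomogeneousRiemannian 𝓘(ℝ, F) 𝓘(ℝ, E) G M) (o : M) :
    GroupLieAlgebra 𝓘(ℝ, F) G →ₗ[ℝ] soLie (TangentSpace 𝓘(ℝ, E) o) where
  toFun X := ⟨kostantOperator 𝓘(ℝ, E) o X, kostantOperator_mem_soLie hM o X⟩
  map_add' X Y := Subtype.ext (kostantOperator_add hM o X Y)
  map_smul' c X := Subtype.ext (kostantOperator_smul hM o c X)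

theorem coe_kostantMap (hM : IsHomogeneousRiemannian 𝓘(ℝ, F) 𝓘(ℝ, E) G M) (o : M)
    (X : GroupLieAlgebra 𝓘(ℝ, F) G) :
    (kostantMap hM o X : Module.End ℝ (TangentSpace 𝓘(ℝ, E) o))
      = kostantOperator 𝓘(ℝ, E) o X := rfl

/-- For a chart-constant field `V`, zero torsion reads `∇_V X^* - ∇_{X^*} V = [V, X^*]`. At `o` the
second term drops out because `X^*` vanishes there, so `K_X = 0` kills the bracket, which is the
chart derivative of `X^*`. -/
theorem fundamentalField_eq_zero_of_kostantOperator_eq_zero [ConnectedSpace M]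
    (hM : IsHomogeneousRiemannian 𝓘(ℝ, F) 𝓘(ℝ, E) G M) (o : M) (X : GroupLieAlgebra 𝓘(ℝ, F) G)
    (h₀ : fundamentalField 𝓘(ℝ, E) X o = 0) (h₁ : kostantOperator 𝓘(ℝ, E) o X = 0) (q : M) :
    fundamentalField 𝓘(ℝ, E) X q = 0 := by
  have : IsContMDiffRiemannianBundle 𝓘(ℝ, E) 1 E (fun x : M => TangentSpace 𝓘(ℝ, E) x) :=
    IsContMDiffRiemannianBundle.of_le (n := ∞) (by simp)
  refine fundamentalField_eq_zero hM o X ((chartField_self o _).trans h₀)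
    (ContinuousLinearMap.ext fun v => ?_) q
  have h := (CovariantDerivative.torsion_eq_zero_iff _).1 (leviCivita_torsion (I := 𝓘(ℝ, E)) (M := M))
    (mdifferentiableAt_chartFrame o v) (mdifferentiableAt_fundamentalField hM X o)
  rw [h₀, map_zero, sub_zero] at h
  have h2 := congrArg (fun L : Module.End ℝ (TangentSpace 𝓘(ℝ, E) o) => L (chartFrame o v o)) h₁
  exact (mlieBracket_chartFrame_left o v _).symm.trans (h.symm.trans h2)

theorem eq_zero_of_kostantMap_eq_zero [CompleteSpace F] [ConnectedSpace M] [T2Space M]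
    (hM : IsHomogeneousRiemannian 𝓘(ℝ, F) 𝓘(ℝ, E) G M) (o : M) {X : GroupLieAlgebra 𝓘(ℝ, F) G}
    (h₀ : fundamentalField 𝓘(ℝ, E) X o = 0) (h₁ : kostantMap hM o X = 0) : X = 0 :=
  have := hM.effective
  eq_zero_of_fundamentalField_eq_zero hM.contMDiff
    (fundamentalField_eq_zero_of_kostantOperator_eq_zero hM o X h₀ (congrArg Subtype.val h₁))

/-- A one-parameter subgroup of the stabilizer fixes `o`, so its orbit has zero velocity; linearity
extends this to the span. -/
theorem fundamentalField_eq_zero_of_mem_stabilizer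
    (hact : ContMDiff (𝓘(ℝ, F).prod 𝓘(ℝ, E)) 𝓘(ℝ, E) ∞ (fun q : G × M => q.1 • q.2)) (o : M)
    {X : GroupLieAlgebra 𝓘(ℝ, F) G}
    (hX : X ∈ subgroupLieAlgebra 𝓘(ℝ, F) (MulAction.stabilizer G o)) :
    fundamentalField 𝓘(ℝ, E) X o = 0 := by
  induction hX using Submodule.span_induction with
  | mem X hX =>
    obtain ⟨γ, ⟨hmul, hγ⟩, hmem⟩ := hX
    have h0 : γ 0 = 1 := by simpa using hmul 0 0
    have h1 : HasMFDerivAt 𝓘(ℝ, F) 𝓘(ℝ, E) (fun a : G => a • o) (γ 0)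
        (mfderiv 𝓘(ℝ, F) 𝓘(ℝ, E) (fun a : G => a • o) (γ 0)) :=
      ((contMDiff_smul_right hact o).mdifferentiableAt (by simp)).hasMFDerivAt
    have h2 : HasMFDerivAt 𝓘(ℝ, ℝ) 𝓘(ℝ, E) (fun _ : ℝ => o) 0 0 := hasMFDerivAt_const o (0 : ℝ)
    have h3 := (h1.comp 0 hγ).mfderiv.symm.trans ((h2.congr_of_eventuallyEq
      (Filter.Eventually.of_forall fun t => hmem t)).mfderiv)
    have h4 : (mfderiv 𝓘(ℝ, F) 𝓘(ℝ, E) (fun a : G => a • o) (γ 0) : F →L[ℝ] E)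
        ((1 : ℝ) • (X : F)) = 0 := congrArg (fun L : ℝ →L[ℝ] E => L 1) h3
    rw [one_smul, h0] at h4
    exact h4
  | zero => exact map_zero (mfderiv 𝓘(ℝ, F) 𝓘(ℝ, E) (fun a : G => a • o) 1)
  | add X Y _ _ hX hY => rw [fundamentalField_add, Pi.add_apply, hX, hY, add_zero]
  | smul c X _ hX => rw [fundamentalField_smul, Pi.smul_apply, hX, smul_zero]

theorem kostantForm_apply {o : M}
    (κ : GroupLieAlgebra 𝓘(ℝ, F) G →ₗ[ℝ] soLie (TangentSpace 𝓘(ℝ, E) o))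
    (X Y : GroupLieAlgebra 𝓘(ℝ, F) G) :
    kostantForm κ X Y = -cartanKilling (TangentSpace 𝓘(ℝ, E) o) (κ X) (κ Y) := rfl

/-- `φ` is positive definite on the Lie algebra of the isotropy group. -/
theorem kostantForm_pos [CompleteSpace F] [ConnectedSpace M] [T2Space M]
    (hM : IsHomogeneousRiemannian 𝓘(ℝ, F) 𝓘(ℝ, E) G M) (o : M) {X : GroupLieAlgebra 𝓘(ℝ, F) G}
    (hX : X ∈ subgroupLieAlgebra 𝓘(ℝ, F) (MulAction.stabilizer G o)) (hne : X ≠ 0) :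
    0 < kostantForm (kostantMap hM o) X X := by
  have : FiniteDimensional ℝ (TangentSpace 𝓘(ℝ, E) o) := finiteDimensional_tangentSpace o
  rw [kostantForm_apply, Left.neg_pos_iff]
  exact cartanKilling_neg fun h => hne <| eq_zero_of_kostantMap_eq_zero hM o
    (fundamentalField_eq_zero_of_mem_stabilizer hM.contMDiff o hX) h

end KostantMap

/-! ### Invariance of the Levi-Civita connection under isometries -/

section Isometries

variable {E : Type*} [NormedAddCommGroup E] [NormedSpace ℝ E] [FiniteDimensional ℝ E]
  [CompleteSpace E]
  {M : Type*} [TopologicalSpace M] [ChartedSpace E M] [IsManifold 𝓘(ℝ, E) ∞ M]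
  [RiemannianBundle (fun x : M => TangentSpace 𝓘(ℝ, E) x)]

theorem inner_mpullback {f : M → M} {p : M}
    (hinv : (mfderiv 𝓘(ℝ, E) 𝓘(ℝ, E) f p).IsInvertible)
    (hiso : ∀ v w : TangentSpace 𝓘(ℝ, E) p,
      inner ℝ (mfderiv 𝓘(ℝ, E) 𝓘(ℝ, E) f p v) (mfderiv 𝓘(ℝ, E) 𝓘(ℝ, E) f p w) = inner ℝ v w)
    (V W : Π x : M, TangentSpace 𝓘(ℝ, E) x) :
    inner ℝ (mpullback 𝓘(ℝ, E) 𝓘(ℝ, E) f V p) (mpullback 𝓘(ℝ, E) 𝓘(ℝ, E) f W p)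
      = inner ℝ (V (f p)) (W (f p)) := by
  rw [← hiso, mpullback_apply, mpullback_apply, hinv.self_apply_inverse, hinv.self_apply_inverse]

variable [IsContMDiffRiemannianBundle 𝓘(ℝ, E) ∞ E (fun x : M => TangentSpace 𝓘(ℝ, E) x)]

/-- The Koszul expression is invariant under isometries. -/
theorem koszul_mpullback {f : M → M} (hf : CMDiff ∞ f)
    (hinv : ∀ p, (mfderiv 𝓘(ℝ, E) 𝓘(ℝ, E) f p).IsInvertible)
    (hiso : ∀ (p : M) (v w : TangentSpace 𝓘(ℝ, E) p),
      inner ℝ (mfderiv 𝓘(ℝ, E) 𝓘(ℝ, E) f p v) (mfderiv 𝓘(ℝ, E) 𝓘(ℝ, E) f p w) = inner ℝ v w)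
    {Y V W : Π x : M, TangentSpace 𝓘(ℝ, E) x} {p : M} (hY : MDiffAt (T% Y) (f p))
    (hV : MDiffAt (T% V) (f p)) (hW : MDiffAt (T% W) (f p)) :
    koszul (mpullback 𝓘(ℝ, E) 𝓘(ℝ, E) f Y) (mpullback 𝓘(ℝ, E) 𝓘(ℝ, E) f V)
      (mpullback 𝓘(ℝ, E) 𝓘(ℝ, E) f W) p = koszul Y V W (f p) := by
  have : IsContMDiffRiemannianBundle 𝓘(ℝ, E) 1 E (fun x : M => TangentSpace 𝓘(ℝ, E) x) :=
    IsContMDiffRiemannianBundle.of_le (n := ∞) (by simp)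
  have hder : ∀ {A B C : Π x : M, TangentSpace 𝓘(ℝ, E) x}, MDiffAt (T% A) (f p) →
      MDiffAt (T% B) (f p) →
      mvfderiv 𝓘(ℝ, E) (fun x => inner ℝ (mpullback 𝓘(ℝ, E) 𝓘(ℝ, E) f A x)
        (mpullback 𝓘(ℝ, E) 𝓘(ℝ, E) f B x)) p (mpullback 𝓘(ℝ, E) 𝓘(ℝ, E) f C p)
      = mvfderiv 𝓘(ℝ, E) (fun x => inner ℝ (A x) (B x)) (f p) (C (f p)) := by
    intro A B C hA hB
    have h : (fun x => inner ℝ (mpullback 𝓘(ℝ, E) 𝓘(ℝ, E) f A x)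
        (mpullback 𝓘(ℝ, E) 𝓘(ℝ, E) f B x)) = (fun x => inner ℝ (A x) (B x)) ∘ f :=
      funext fun x => inner_mpullback (hinv x) (hiso x) A B
    rw [h, mvfderiv_comp_apply p (mdifferentiableAt_inner hA hB) (hf.mdifferentiableAt (by simp)),
      mpullback_apply, (hinv p).self_apply_inverse]
  have hbr : ∀ {A B C : Π x : M, TangentSpace 𝓘(ℝ, E) x}, MDiffAt (T% A) (f p) →
      MDiffAt (T% B) (f p) →
      inner ℝ (mlieBracket 𝓘(ℝ, E) (mpullback 𝓘(ℝ, E) 𝓘(ℝ, E) f A)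
        (mpullback 𝓘(ℝ, E) 𝓘(ℝ, E) f B) p) (mpullback 𝓘(ℝ, E) 𝓘(ℝ, E) f C p)
      = inner ℝ (mlieBracket 𝓘(ℝ, E) A B (f p)) (C (f p)) := by
    intro A B C hA hB
    have : IsManifold 𝓘(ℝ, E) (minSmoothness ℝ 3) M :=
      IsManifold.of_le (n := ∞) (by simpa using ENat.LEInfty.out)
    rw [← mpullback_mlieBracket hA hB hf.contMDiffAt (n := ∞) (by simpa using two_le_infty)]
    exact inner_mpullback (hinv p) (hiso p) _ _
  simp only [koszul, hder hY hW, hder hV hW, hder hV hY, hbr hV hY, hbr hV hW, hbr hY hW]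

/-- Isometries preserve the Levi-Civita connection. -/
theorem inner_leviCivitaFun_mfderiv {f : M → M} (hf : CMDiff ∞ f)
    (hinv : ∀ p, (mfderiv 𝓘(ℝ, E) 𝓘(ℝ, E) f p).IsInvertible)
    (hiso : ∀ (p : M) (v w : TangentSpace 𝓘(ℝ, E) p),
      inner ℝ (mfderiv 𝓘(ℝ, E) 𝓘(ℝ, E) f p v) (mfderiv 𝓘(ℝ, E) 𝓘(ℝ, E) f p w) = inner ℝ v w)
    {Y : Π x : M, TangentSpace 𝓘(ℝ, E) x} {p : M} (hY : MDiffAt (T% Y) (f p))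
    (v w : TangentSpace 𝓘(ℝ, E) p) :
    haveI : IsContMDiffRiemannianBundle 𝓘(ℝ, E) 1 E (fun x : M => TangentSpace 𝓘(ℝ, E) x) :=
      IsContMDiffRiemannianBundle.of_le (n := ∞) (by simp)
    inner ℝ (leviCivitaFun Y (f p) (mfderiv 𝓘(ℝ, E) 𝓘(ℝ, E) f p v))
      (mfderiv 𝓘(ℝ, E) 𝓘(ℝ, E) f p w)
      = inner ℝ (leviCivitaFun (mpullback 𝓘(ℝ, E) 𝓘(ℝ, E) f Y) p v) w := by
  have : IsContMDiffRiemannianBundle 𝓘(ℝ, E) 1 E (fun x : M => TangentSpace 𝓘(ℝ, E) x) :=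
    IsContMDiffRiemannianBundle.of_le (n := ∞) (by simp)
  -- Test fields are chosen at `f p`, extending the image of `u`, so that their pullbacks recover
  -- `u` at `p`.
  have hext : ∀ u : TangentSpace 𝓘(ℝ, E) p, ∃ V : Π x : M, TangentSpace 𝓘(ℝ, E) x,
      MDiffAt (T% V) (f p) ∧ V (f p) = mfderiv 𝓘(ℝ, E) 𝓘(ℝ, E) f p u ∧
      mpullback 𝓘(ℝ, E) 𝓘(ℝ, E) f V p = u := by
    intro u
    have hV : FiberBundle.extend E (mfderiv 𝓘(ℝ, E) 𝓘(ℝ, E) f p u) (f p)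
        = mfderiv 𝓘(ℝ, E) 𝓘(ℝ, E) f p u := by simp
    refine ⟨FiberBundle.extend E (mfderiv 𝓘(ℝ, E) 𝓘(ℝ, E) f p u),
      FiberBundle.mdifferentiableAt_extend .., hV, ?_⟩
    rw [mpullback_apply, hV, (hinv p).inverse_apply_self]
  obtain ⟨V, hV, hVf, hVp⟩ := hext v
  obtain ⟨W, hW, hWf, hWp⟩ := hext w
  have hpull : ∀ {A : Π x : M, TangentSpace 𝓘(ℝ, E) x}, MDiffAt (T% A) (f p) →
      MDiffAt (T% (mpullback 𝓘(ℝ, E) 𝓘(ℝ, E) f A)) p := fun hA =>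
    hA.mpullback_vectorField (n := ∞) hf.contMDiffAt (hinv p) two_le_infty
  rw [← hVf, ← hWf, inner_leviCivitaFun hY hV hW,
    ← koszul_mpullback hf hinv hiso hY hV hW, ← inner_leviCivitaFun (hpull hY) (hpull hV) (hpull hW),
    hVp, hWp]

end Isometries

/-! ### Equivariance of the Kostant operator under the isotropy group -/

section Equivariance

variable {F : Type*} [NormedAddCommGroup F] [NormedSpace ℝ F]
  {E : Type*} [NormedAddCommGroup E] [NormedSpace ℝ E] [FiniteDimensional ℝ E] [CompleteSpace E]
  {G : Type*} [TopologicalSpace G] [ChartedSpace F G] [Group G] [LieGroup 𝓘(ℝ, F) ∞ G]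
  {M : Type*} [TopologicalSpace M] [ChartedSpace E M] [MulAction G M] [IsManifold 𝓘(ℝ, E) ∞ M]

theorem isInvertible_mfderiv_smul_left
    (hact : ContMDiff (𝓘(ℝ, F).prod 𝓘(ℝ, E)) 𝓘(ℝ, E) ∞ (fun q : G × M => q.1 • q.2))
    (a : G) (p : M) :
    (mfderiv 𝓘(ℝ, E) 𝓘(ℝ, E) (fun q : M => a • q) p).IsInvertible := by
  let e : M ≃ₘ^∞⟮𝓘(ℝ, E), 𝓘(ℝ, E)⟯ M :=
    { MulAction.toPerm a with
      contMDiff_toFun := contMDiff_smul_left hact a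
      contMDiff_invFun := contMDiff_smul_left hact a⁻¹ }
  exact ⟨e.mfderivToContinuousLinearEquiv (by simp) p,
    e.mfderivToContinuousLinearEquiv_coe (by simp)⟩

theorem hasMFDerivAt_conj (a : G) :
    HasMFDerivAt 𝓘(ℝ, F) 𝓘(ℝ, F) (fun x : G => a * x * a⁻¹) 1
      (mfderiv 𝓘(ℝ, F) 𝓘(ℝ, F) (fun x : G => a * x * a⁻¹) 1) :=
  (((contMDiff_mul_right (a := a⁻¹)).comp (contMDiff_mul_left (a := a))).mdifferentiableAt
    (n := ∞) (by simp)).hasMFDerivAt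

/-- Differentiate `(a * b * a⁻¹) • (a • p) = a • (b • p)` in `b` at `1`. -/
theorem fundamentalField_Ad
    (hact : ContMDiff (𝓘(ℝ, F).prod 𝓘(ℝ, E)) 𝓘(ℝ, E) ∞ (fun q : G × M => q.1 • q.2))
    (a : G) (X : GroupLieAlgebra 𝓘(ℝ, F) G) (p : M) :
    (fundamentalField 𝓘(ℝ, E) (Ad 𝓘(ℝ, F) a X) (a • p) : E)
      = mfderiv 𝓘(ℝ, E) 𝓘(ℝ, E) (fun q : M => a • q) p (fundamentalField 𝓘(ℝ, E) X p) := by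
  have h2 : HasMFDerivAt 𝓘(ℝ, F) 𝓘(ℝ, E) (fun b : G => b • a • p) (a * 1 * a⁻¹)
      (mfderiv 𝓘(ℝ, F) 𝓘(ℝ, E) (fun b : G => b • a • p) (a * 1 * a⁻¹)) :=
    ((contMDiff_smul_right hact (a • p)).mdifferentiableAt (by simp)).hasMFDerivAt
  have h3 : HasMFDerivAt 𝓘(ℝ, F) 𝓘(ℝ, E) (fun b : G => b • p) 1
      (mfderiv 𝓘(ℝ, F) 𝓘(ℝ, E) (fun b : G => b • p) 1) :=
    ((contMDiff_smul_right hact p).mdifferentiableAt (by simp)).hasMFDerivAt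
  have h4 : HasMFDerivAt 𝓘(ℝ, E) 𝓘(ℝ, E) (fun q : M => a • q) ((1 : G) • p)
      (mfderiv 𝓘(ℝ, E) 𝓘(ℝ, E) (fun q : M => a • q) ((1 : G) • p)) :=
    ((contMDiff_smul_left hact a).mdifferentiableAt (by simp)).hasMFDerivAt
  have h5 := (h2.comp 1 (hasMFDerivAt_conj a)).mfderiv.symm.trans
    (((h4.comp 1 h3).congr_of_eventuallyEq
      (Filter.Eventually.of_forall fun b => by simp [mul_smul])).mfderiv)
  have h6 : (mfderiv 𝓘(ℝ, F) 𝓘(ℝ, E) (fun b : G => b • a • p) (a * 1 * a⁻¹) : F →L[ℝ] E)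
      (Ad 𝓘(ℝ, F) a X : F)
      = (mfderiv 𝓘(ℝ, E) 𝓘(ℝ, E) (fun q : M => a • q) ((1 : G) • p) : E →L[ℝ] E)
        (fundamentalField 𝓘(ℝ, E) X p : E) := congrArg (fun L : F →L[ℝ] E => L X) h5
  rw [mul_one, mul_inv_cancel, one_smul G p] at h6
  exact h6

theorem mpullback_fundamentalField_Ad
    (hact : ContMDiff (𝓘(ℝ, F).prod 𝓘(ℝ, E)) 𝓘(ℝ, E) ∞ (fun q : G × M => q.1 • q.2))
    (a : G) (X : GroupLieAlgebra 𝓘(ℝ, F) G) :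
    mpullback 𝓘(ℝ, E) 𝓘(ℝ, E) (fun q : M => a • q) (fundamentalField 𝓘(ℝ, E) (Ad 𝓘(ℝ, F) a X))
      = fundamentalField 𝓘(ℝ, E) X := by
  ext1 p
  rw [mpullback_apply]
  exact (congrArg (mfderiv 𝓘(ℝ, E) 𝓘(ℝ, E) (fun q : M => a • q) p).inverse
    (fundamentalField_Ad hact a X p)).trans
    ((isInvertible_mfderiv_smul_left hact a p).inverse_apply_self _)

variable [RiemannianBundle (fun x : M => TangentSpace 𝓘(ℝ, E) x)]
  [IsContMDiffRiemannianBundle 𝓘(ℝ, E) ∞ E (fun x : M => TangentSpace 𝓘(ℝ, E) x)]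

theorem inner_kostantOperator_Ad (hM : IsHomogeneousRiemannian 𝓘(ℝ, F) 𝓘(ℝ, E) G M) (a : G)
    (o : M) (X : GroupLieAlgebra 𝓘(ℝ, F) G) (v w : TangentSpace 𝓘(ℝ, E) o) :
    inner ℝ (kostantOperator 𝓘(ℝ, E) (a • o) (Ad 𝓘(ℝ, F) a X)
        (mfderiv 𝓘(ℝ, E) 𝓘(ℝ, E) (fun q : M => a • q) o v))
      (mfderiv 𝓘(ℝ, E) 𝓘(ℝ, E) (fun q : M => a • q) o w)
      = inner ℝ (kostantOperator 𝓘(ℝ, E) o X v) w := by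
  have h := inner_leviCivitaFun_mfderiv (contMDiff_smul_left hM.contMDiff a)
    (isInvertible_mfderiv_smul_left hM.contMDiff a) (hM.isometric a)
    (mdifferentiableAt_fundamentalField hM (Ad 𝓘(ℝ, F) a X) (a • o)) v w
  rw [mpullback_fundamentalField_Ad hM.contMDiff] at h
  exact h

/-- The isotropy representation. -/
def isotropyIsometry (hM : IsHomogeneousRiemannian 𝓘(ℝ, F) 𝓘(ℝ, E) G M) {o : M} {a : G}
    (ha : a • o = o) : TangentSpace 𝓘(ℝ, E) o ≃ₗᵢ[ℝ] TangentSpace 𝓘(ℝ, E) o :=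
  haveI : FiniteDimensional ℝ (TangentSpace 𝓘(ℝ, E) o) := finiteDimensional_tangentSpace o
  LinearIsometry.toLinearIsometryEquiv
    (LinearMap.isometryOfInner
      ((mfderiv 𝓘(ℝ, E) 𝓘(ℝ, E) (fun q : M => a • q) o : E →L[ℝ] E).toLinearMap :
        TangentSpace 𝓘(ℝ, E) o →ₗ[ℝ] TangentSpace 𝓘(ℝ, E) o)
      (fun v w => by
        -- The isometry property lives in the tangent space at `a • o`, which equals `o` only
        -- through `ha`; generalising the point to `q` transports the inner product.
        have h : ∀ q : M, q = o → ∀ x y : E,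
            @inner ℝ (TangentSpace 𝓘(ℝ, E) o) _ x y = @inner ℝ (TangentSpace 𝓘(ℝ, E) q) _ x y := by
          rintro q rfl x y; rfl
        exact (h _ ha _ _).trans (hM.isometric a o v w))) rfl

theorem kostantOperator_Ad (hM : IsHomogeneousRiemannian 𝓘(ℝ, F) 𝓘(ℝ, E) G M) {o : M} {a : G}
    (ha : a • o = o) (X : GroupLieAlgebra 𝓘(ℝ, F) G) (v : TangentSpace 𝓘(ℝ, E) o) :
    kostantOperator 𝓘(ℝ, E) o (Ad 𝓘(ℝ, F) a X) (isotropyIsometry hM ha v)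
      = isotropyIsometry hM ha (kostantOperator 𝓘(ℝ, E) o X v) := by
  refine ext_inner_right ℝ fun w => ?_
  obtain ⟨w, rfl⟩ := (isotropyIsometry hM ha).surjective w
  rw [LinearIsometryEquiv.inner_map_map]
  have h : ∀ q : M, q = o → ∀ x y : E,
      inner ℝ (kostantOperator 𝓘(ℝ, E) o (Ad 𝓘(ℝ, F) a X) (x : TangentSpace 𝓘(ℝ, E) o))
        (y : TangentSpace 𝓘(ℝ, E) o)
      = inner ℝ (kostantOperator 𝓘(ℝ, E) q (Ad 𝓘(ℝ, F) a X) (x : TangentSpace 𝓘(ℝ, E) q))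
        (y : TangentSpace 𝓘(ℝ, E) q) := by
    rintro q rfl x y; rfl
  exact (h _ ha _ _).trans (inner_kostantOperator_Ad hM a o X v w)

attribute [local instance 100] LieRing.ofAssociativeRing

/-- The isotropy isometry intertwines the two Kostant operators; stated as a conjugation, this lets
`cartanKilling_conj` apply. -/
theorem kostantMap_Ad (hM : IsHomogeneousRiemannian 𝓘(ℝ, F) 𝓘(ℝ, E) G M) {o : M} {a : G}
    (ha : a • o = o) (X : GroupLieAlgebra 𝓘(ℝ, F) G) :
    kostantMap hM o (Ad 𝓘(ℝ, F) a X) = soLieConj (isotropyIsometry hM ha) (kostantMap hM o X) := by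
  refine Subtype.ext (LinearMap.ext fun v => ?_)
  obtain ⟨v, rfl⟩ := (isotropyIsometry hM ha).surjective v
  have : FiniteDimensional ℝ (TangentSpace 𝓘(ℝ, E) o) := finiteDimensional_tangentSpace o
  rw [coe_soLieConj, coe_kostantMap, coe_kostantMap, kostantOperator_Ad, LinearEquiv.conj_apply_apply]
  simp

/-- The form `φ` is invariant under the adjoint action of the isotropy group. -/
theorem kostantForm_Ad (hM : IsHomogeneousRiemannian 𝓘(ℝ, F) 𝓘(ℝ, E) G M) {o : M} {a : G}
    (ha : a • o = o) (X Y : GroupLieAlgebra 𝓘(ℝ, F) G) :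
    kostantForm (kostantMap hM o) (Ad 𝓘(ℝ, F) a X) (Ad 𝓘(ℝ, F) a Y)
      = kostantForm (kostantMap hM o) X Y := by
  have : FiniteDimensional ℝ (TangentSpace 𝓘(ℝ, E) o) := finiteDimensional_tangentSpace o
  rw [kostantForm_apply, kostantForm_apply, kostantMap_Ad hM ha, kostantMap_Ad hM ha,
    cartanKilling_conj]

end Equivariance

/-! ### Orthogonal complements for a form positive on a subspace -/

section OrthogonalComplement

/-- A subspace on which a bilinear form is positive is complemented by its orthogonal. -/
theorem isCompl_orthogonalIn {V : Type*} [AddCommGroup V] [Module ℝ V]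
    (φ : LinearMap.BilinForm ℝ V) (W : Submodule ℝ V) [FiniteDimensional ℝ W]
    (hφ : ∀ X ∈ W, X ≠ 0 → 0 < φ X X) : IsCompl W (orthogonalIn φ W) := by
  -- Positivity makes `r` injective on `W`, hence bijective onto the dual by dimension. The preimage
  -- in `W` of `r X` is the projection of `X`; neither symmetry nor positivity of `φ` on all of `V`
  -- is needed.
  let r : V →ₗ[ℝ] Module.Dual ℝ W := φ.compl₂ W.subtype
  have hinj : Function.Injective (r ∘ₗ W.subtype) := by
    rw [← LinearMap.ker_eq_bot, LinearMap.ker_eq_bot']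
    intro X hX
    by_contra hne
    exact (hφ X X.2 (by simpa using hne)).ne' (LinearMap.congr_fun hX X)
  have hsurj : Function.Surjective (r ∘ₗ W.subtype) :=
    (LinearMap.injective_iff_surjective_of_finrank_eq_finrank
      Subspace.dual_finrank_eq.symm).1 hinj
  constructor
  · rw [Submodule.disjoint_def]
    intro X hX hX'
    by_contra hne
    exact (hφ X hX hne).ne' (hX' X hX)
  · rw [codisjoint_iff, eq_top_iff]
    intro X _
    obtain ⟨Y, hY⟩ := hsurj (r X)
    refine Submodule.mem_sup.2 ⟨Y, Y.2, X - Y, fun Z hZ => ?_, add_sub_cancel _ _⟩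
    have h : φ Y Z = φ X Z := LinearMap.congr_fun hY ⟨Z, hZ⟩
    rw [map_sub, LinearMap.sub_apply, h, sub_self]

end OrthogonalComplement

/-! ### Adjoint action and Lie subgroups -/

section AdjointAction

variable {F : Type*} [NormedAddCommGroup F] [NormedSpace ℝ F]
  {G : Type*} [TopologicalSpace G] [ChartedSpace F G] [Group G] [LieGroup 𝓘(ℝ, F) ∞ G]
  {F' : Type*} [NormedAddCommGroup F'] [NormedSpace ℝ F']
  {G' : Type*} [TopologicalSpace G'] [ChartedSpace F' G'] [Group G'] [LieGroup 𝓘(ℝ, F') ∞ G']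

theorem IsOneParameterSubgroup.zero {γ : ℝ → G} {X : GroupLieAlgebra 𝓘(ℝ, F) G}
    (hγ : IsOneParameterSubgroup γ X) : γ 0 = 1 := by
  simpa using hγ.1 0 0

theorem Ad_add (a : G) (X Y : GroupLieAlgebra 𝓘(ℝ, F) G) :
    Ad 𝓘(ℝ, F) a (X + Y) = Ad 𝓘(ℝ, F) a X + Ad 𝓘(ℝ, F) a Y :=
  map_add (mfderiv 𝓘(ℝ, F) 𝓘(ℝ, F) (fun x : G => a * x * a⁻¹) 1) X Y

theorem Ad_smul (a : G) (c : ℝ) (X : GroupLieAlgebra 𝓘(ℝ, F) G) :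
    Ad 𝓘(ℝ, F) a (c • X) = c • Ad 𝓘(ℝ, F) a X :=
  map_smul (mfderiv 𝓘(ℝ, F) 𝓘(ℝ, F) (fun x : G => a * x * a⁻¹) 1) c X

theorem Ad_zero (a : G) : Ad 𝓘(ℝ, F) a (0 : GroupLieAlgebra 𝓘(ℝ, F) G) = 0 :=
  map_zero (mfderiv 𝓘(ℝ, F) 𝓘(ℝ, F) (fun x : G => a * x * a⁻¹) 1)

/-- Chain rules produce base points such as `γ 0` or `a⁻¹ * 1 * a⁻¹⁻¹`, which equal `1` only
propositionally. -/
theorem hasMFDerivAt_conj_of_eq_one (a : G) {b : G} (hb : b = 1) :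
    HasMFDerivAt 𝓘(ℝ, F) 𝓘(ℝ, F) (fun x : G => a * x * a⁻¹) b
      (mfderiv 𝓘(ℝ, F) 𝓘(ℝ, F) (fun x : G => a * x * a⁻¹) 1 : F →L[ℝ] F) := by
  subst hb
  exact hasMFDerivAt_conj a

theorem Ad_Ad_inv (a : G) (X : GroupLieAlgebra 𝓘(ℝ, F) G) :
    Ad 𝓘(ℝ, F) a (Ad 𝓘(ℝ, F) a⁻¹ X) = X := by
  have h := (hasMFDerivAt_conj_of_eq_one (F := F) a (b := a⁻¹ * 1 * a⁻¹⁻¹) (by simp)).comp 1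
    (hasMFDerivAt_conj a⁻¹)
  have h' := h.mfderiv.symm.trans (((hasMFDerivAt_id (I := 𝓘(ℝ, F)) (1 : G)).congr_of_eventuallyEq
    (Filter.Eventually.of_forall fun b => by simp [mul_assoc])).mfderiv)
  exact congrArg (fun L : F →L[ℝ] F => L X) h'

/-- Conjugation by an element of `K` carries one-parameter subgroups of `K` to one-parameter
subgroups of `K`. -/
theorem Ad_mem_subgroupLieAlgebra {K : Subgroup G} {a : G} (ha : a ∈ K)
    {X : GroupLieAlgebra 𝓘(ℝ, F) G} (hX : X ∈ subgroupLieAlgebra 𝓘(ℝ, F) K) :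
    Ad 𝓘(ℝ, F) a X ∈ subgroupLieAlgebra 𝓘(ℝ, F) K := by
  induction hX using Submodule.span_induction with
  | mem X hX =>
    obtain ⟨γ, hγ, hmem⟩ := hX
    refine Submodule.subset_span ⟨fun t => a * γ t * a⁻¹, ⟨fun s t => ?_, ?_⟩,
      fun t => K.mul_mem (K.mul_mem ha (hmem t)) (K.inv_mem ha)⟩
    · change a * γ (s + t) * a⁻¹ = a * γ s * a⁻¹ * (a * γ t * a⁻¹)
      rw [hγ.1]; group
    · refine ((hasMFDerivAt_conj_of_eq_one a hγ.zero).comp 0 hγ.2).congr_mfderiv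
        (ContinuousLinearMap.ext (M₁ := ℝ) (M₂ := F) fun r => ?_)
      exact map_smul (mfderiv 𝓘(ℝ, F) 𝓘(ℝ, F) (fun x : G => a * x * a⁻¹) 1 : F →L[ℝ] F) r X
  | zero => rw [Ad_zero]; exact zero_mem _
  | add X Y _ _ hX hY => rw [Ad_add]; exact add_mem hX hY
  | smul c X _ hX => rw [Ad_smul]; exact Submodule.smul_mem _ c hX

variable {ι : G →* G'}

theorem hasMFDerivAt_lieMap (hι : IsLieSubgroup 𝓘(ℝ, F) 𝓘(ℝ, F') ι) {b : G} (hb : b = 1) :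
    HasMFDerivAt 𝓘(ℝ, F) 𝓘(ℝ, F') ι b (mfderiv 𝓘(ℝ, F) 𝓘(ℝ, F') ι 1 : F →L[ℝ] F') := by
  subst hb
  exact (hι.contMDiff.mdifferentiableAt (by simp)).hasMFDerivAt

theorem lieMap_mem_subgroupLieAlgebra (hι : IsLieSubgroup 𝓘(ℝ, F) 𝓘(ℝ, F') ι) {K : Subgroup G'}
    {X : GroupLieAlgebra 𝓘(ℝ, F) G} (hX : X ∈ subgroupLieAlgebra 𝓘(ℝ, F) (K.comap ι)) :
    lieMap 𝓘(ℝ, F) 𝓘(ℝ, F') ι X ∈ subgroupLieAlgebra 𝓘(ℝ, F') K := by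
  induction hX using Submodule.span_induction with
  | mem X hX =>
    obtain ⟨γ, hγ, hmem⟩ := hX
    refine Submodule.subset_span ⟨fun t => ι (γ t), ⟨fun s t => ?_, ?_⟩, hmem⟩
    · change ι (γ (s + t)) = ι (γ s) * ι (γ t)
      rw [hγ.1, map_mul]
    · refine ((hasMFDerivAt_lieMap hι hγ.zero).comp 0 hγ.2).congr_mfderiv
        (ContinuousLinearMap.ext (M₁ := ℝ) (M₂ := F') fun r => ?_)
      exact map_smul (mfderiv 𝓘(ℝ, F) 𝓘(ℝ, F') ι 1 : F →L[ℝ] F') r X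
  | zero => rw [map_zero]; exact zero_mem _
  | add X Y _ _ hX hY => rw [map_add]; exact add_mem hX hY
  | smul c X _ hX => rw [map_smul]; exact Submodule.smul_mem _ c hX

theorem lieMap_ne_zero (hι : IsLieSubgroup 𝓘(ℝ, F) 𝓘(ℝ, F') ι) {X : GroupLieAlgebra 𝓘(ℝ, F) G}
    (hX : X ≠ 0) : lieMap 𝓘(ℝ, F) 𝓘(ℝ, F') ι X ≠ 0 := fun h =>
  hX (hι.mfderiv_injective 1 (Eq.trans h (map_zero (mfderiv 𝓘(ℝ, F) 𝓘(ℝ, F') ι 1)).symm))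

/-- Differentiate `ι (a * b * a⁻¹) = ι a * ι b * (ι a)⁻¹` in `b` at `1`. -/
theorem lieMap_Ad (hι : IsLieSubgroup 𝓘(ℝ, F) 𝓘(ℝ, F') ι) (a : G)
    (X : GroupLieAlgebra 𝓘(ℝ, F) G) :
    lieMap 𝓘(ℝ, F) 𝓘(ℝ, F') ι (Ad 𝓘(ℝ, F) a X)
      = Ad 𝓘(ℝ, F') (ι a) (lieMap 𝓘(ℝ, F) 𝓘(ℝ, F') ι X) := by
  have h1 := (hasMFDerivAt_lieMap hι (b := a * 1 * a⁻¹) (by simp)).comp 1 (hasMFDerivAt_conj a)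
  have h2 := (hasMFDerivAt_conj_of_eq_one (F := F') (ι a) (map_one ι)).comp 1
    (hasMFDerivAt_lieMap hι rfl)
  have h3 := h1.mfderiv.symm.trans ((h2.congr_of_eventuallyEq
    (Filter.Eventually.of_forall fun b => by simp)).mfderiv)
  exact congrArg (fun L : F →L[ℝ] F' => L X) h3

end AdjointAction

theorem theorem3p1 {n d k : ℕ}
    -- a connected Riemannian manifold `Mbar` of dimension `n`
    {Mbar : Type*} [TopologicalSpace Mbar] [ChartedSpace (EuclideanSpace ℝ (Fin n)) Mbar]
    [IsManifold (𝓡 n) ∞ Mbar] [T2Space Mbar] [ConnectedSpace Mbar]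
    [RiemannianBundle (fun x : Mbar => TangentSpace (𝓡 n) x)]
    [IsContMDiffRiemannianBundle (𝓡 n) ∞ (EuclideanSpace ℝ (Fin n))
      (fun x : Mbar => TangentSpace (𝓡 n) x)]
    -- a Lie group `Gbar` with `Mbar = Gbar / stabilizer o`
    {Gbar : Type*} [TopologicalSpace Gbar] [ChartedSpace (EuclideanSpace ℝ (Fin d)) Gbar] [Group Gbar]
    [LieGroup (𝓡 d) ∞ Gbar] [T2Space Gbar] [MulAction Gbar Mbar]
    (hM : IsHomogeneousRiemannian (𝓡 d) (𝓡 n) Gbar Mbar) (o : Mbar)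
    (mbar : Submodule ℝ (GroupLieAlgebra (𝓡 d) Gbar))
    (hmbar : IsReductiveDecomposition (MulAction.stabilizer Gbar o) mbar)
    -- a Lie subgroup `G` of `Gbar`, with closed orbit through `o`
    {G : Type*} [TopologicalSpace G] [ChartedSpace (EuclideanSpace ℝ (Fin k)) G] [Group G]
    [LieGroup (𝓡 k) ∞ G] [T2Space G]
    (ι : G →* Gbar) (hι : IsLieSubgroup (𝓡 k) (𝓡 d) ι)
    (hclosed : IsClosed (Set.range fun a : G => ι a • o)) :
    ∃ κ : GroupLieAlgebra (𝓡 d) Gbar →ₗ[ℝ] soLie (TangentSpace (𝓡 n) o),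
      (∀ X, (κ X : Module.End ℝ (TangentSpace (𝓡 n) o)) = kostantOperator (𝓡 n) o X) ∧
      (∀ X ∈ subgroupLieAlgebra (𝓡 d) (MulAction.stabilizer Gbar o), X ≠ 0 →
        0 < kostantForm κ X X) ∧
      IsReductiveDecomposition ((MulAction.stabilizer Gbar o).comap ι)
        (orthogonalIn ((kostantForm κ).compl₁₂ (lieMap (𝓡 k) (𝓡 d) ι) (lieMap (𝓡 k) (𝓡 d) ι))
          (subgroupLieAlgebra (𝓡 k) ((MulAction.stabilizer Gbar o).comap ι))) := by
  have : FiniteDimensional ℝ (GroupLieAlgebra (𝓡 k) G) := finiteDimensional_tangentSpace 1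
  refine ⟨kostantMap hM o, coe_kostantMap hM o, fun X hX => kostantForm_pos hM o hX,
    isCompl_orthogonalIn _ _ fun X hX hne => kostantForm_pos hM o
      (lieMap_mem_subgroupLieAlgebra hι hX) (lieMap_ne_zero hι hne), fun a ha X hX Y hY => ?_⟩
  -- Writing `Y = Ad a (Ad a⁻¹ Y)`, invariance of the form moves `a` off `X`, and `Ad a⁻¹ Y` stays
  -- in the Lie algebra of `H`.
  rw [← Ad_Ad_inv a Y, LinearMap.compl₁₂_apply, lieMap_Ad hι, lieMap_Ad hι,
    kostantForm_Ad hM (a := ι a) ha]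
  exact hX _ (Ad_mem_subgroupLieAlgebra (inv_mem ha) hY)

end
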